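/- Let $m\ge 2$ and let $M$ be a simply connected (in particular connected) Hausdorff smooth manifold of dimension $m$ without boundary. An affine structure on $M$ is a smooth torsion-free connection $\nabla$ on $TM$. For $g\in C^\infty(M)$ let ${}^g\nabla$ be the connection ${}^g\nabla_XY:=\nabla_XY+X(g)Y+Y(g)X$; $\nabla$ is called strongly projectively flat if ${}^g\nabla$ is flat (has vanishing curvature) for some $g\in C^\infty(M)$. Let $R(X,Y)Z=\nabla_X\nabla_YZ-\nabla_Y\nabla_XZ-\nabla_{[X,Y]}Z$ be the curvature, $\rho_\nabla(Y,Z)=\operatorname{Tr}(X\mapsto R(X,Y)Z)$ the Ricci tensor, $\rho_{\nabla,s}(Y,Z)=\frac12(\rho_\nabla(Y,Z)+\rho_\nabla(Z,Y))$ its symmetrization, $(\mathcal H_\nabla f)(X,Y)=X(Yf)-(\nabla_XY)f$ the Hessian, and $$\mathcal Q(M,\nabla):=\Big\{f\in C^\infty(M)\;:\;\mathcal H_\nabla f+\tfrac1{m-1}\,f\,\rho_{\nabla,s}=0\Big\}.$$ **Theorem 1.4.** Let $\nabla_1,\nabla_2$ be two strongly projectively flat affine structures on $M$, and let $\Xi:M\to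 M$ be a (smooth) diffeomorphism. 1. If $\mathcal Q(M,\nabla_1)=\mathcal Q(M,\nabla_2)$, then $\nabla_1=\nabla_2$. 2. If $\Xi^*\mathcal Q(M,\nabla_1)=\mathcal Q(M,\nabla_2)$, then $\Xi^*\nabla_1=\nabla_2$. Here $\Xi^*\mathcal Q(M,\nabla_1)=\{f\circ\Xi : f\in\mathcal Q(M,\nabla_1)\}$ and $(\Xi^*\nabla_1)_XY=(\Xi_*)^{-1}\big((\nabla_1)_{\Xi_*X}(\Xi_*Y)\big)$. -/

import Mathlib

open Bundle VectorField
open scoped Manifold ContDiff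

noncomputable section

namespace AffineGeometry

/-- Smooth vector fields on the `m`-dimensional manifold `M`. -/
abbrev SmoothVF (m : ℕ) (M : Type*) [TopologicalSpace M]
    [ChartedSpace (EuclideanSpace ℝ (Fin m)) M] [IsManifold (𝓡 m) ∞ M] :=
  Cₛ^∞⟮𝓡 m; EuclideanSpace ℝ (Fin m), (TangentSpace (𝓡 m) : M → Type _)⟯

/-- Connections on the tangent bundle of `M`, without regularity assumptions on the coefficients.
Mathlib writes `∇ Y x (X x)` for the value of `∇_X Y` at `x`. -/
abbrev TangentConnection (m : ℕ) (M : Type*) [TopologicalSpace M]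
    [ChartedSpace (EuclideanSpace ℝ (Fin m)) M] [IsManifold (𝓡 m) ∞ M] :=
  CovariantDerivative (𝓡 m) (EuclideanSpace ℝ (Fin m)) (TangentSpace (𝓡 m) : M → Type _)

/-- An affine structure on `M`: a smooth torsion-free connection on the tangent bundle. -/
structure AffineStructure (m : ℕ) (M : Type*) [TopologicalSpace M]
    [ChartedSpace (EuclideanSpace ℝ (Fin m)) M] [IsManifold (𝓡 m) ∞ M] where
  /-- The underlying connection. -/
  conn : TangentConnection m M
  /-- `∇ Y` is smooth whenever `Y` is. -/
  smooth : CovariantDerivative.ContMDiffCovariantDerivative conn ∞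
  /-- The torsion tensor `∇_X Y - ∇_Y X - [X, Y]` vanishes. -/
  torsion_free : conn.torsion = 0

variable {m : ℕ} {M : Type*} [TopologicalSpace M]
  [ChartedSpace (EuclideanSpace ℝ (Fin m)) M] [IsManifold (𝓡 m) ∞ M]

/-- The vector field `Y` is differentiable at the point `x`. -/
abbrev VFDiffAt (Y : Π x : M, TangentSpace (𝓡 m) x) (x : M) : Prop :=
  MDifferentiableAt (𝓡 m) ((𝓡 m).prod 𝓘(ℝ, EuclideanSpace ℝ (Fin m)))
    (fun y ↦ (⟨y, Y y⟩ : TangentBundle (𝓡 m) M)) x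

/-- Equality of connections. Mathlib's covariant derivatives carry arbitrary values on vector
fields that are not differentiable at the point considered; two connections are the same when they
agree on all vector fields wherever those are differentiable. -/
def SameConnection (D D' : TangentConnection m M) : Prop :=
  ∀ (Y : Π x : M, TangentSpace (𝓡 m) x) (x : M),
    VFDiffAt Y x → D Y x = D' Y x

/-- The curvature operator
`R(X, Y) Z = ∇_X ∇_Y Z - ∇_Y ∇_X Z - ∇_{[X, Y]} Z` at the point `x`. -/
def curvature (D : TangentConnection m M) (X Y Z : Π x : M, TangentSpace (𝓡 m) x) (x : M) :
    TangentSpace (𝓡 m) x :=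
  D (fun q ↦ D Z q (Y q)) x (X x) - D (fun q ↦ D Z q (X q)) x (Y x)
    - D Z x (mlieBracket (𝓡 m) X Y x)

/-- A connection is flat if its curvature vanishes. -/
def IsFlat (D : TangentConnection m M) : Prop :=
  ∀ (X Y Z : SmoothVF m M) (x : M), curvature D X Y Z x = 0

/-- The symmetric bilinear map `(v, w) ↦ φ(v) w + φ(w) v` determined by a linear form `φ`. -/
def symProd (φ : EuclideanSpace ℝ (Fin m) →L[ℝ] ℝ) :
    EuclideanSpace ℝ (Fin m) →L[ℝ] EuclideanSpace ℝ (Fin m) →L[ℝ] EuclideanSpace ℝ (Fin m) :=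
  φ.smulRight (ContinuousLinearMap.id ℝ _) + (φ.smulRight (ContinuousLinearMap.id ℝ _)).flip

/-- The perturbed connection `^g∇_X Y = ∇_X Y + X(g) Y + Y(g) X`. -/
def perturb (D : TangentConnection m M) (g : C^∞⟮𝓡 m, M; 𝓘(ℝ, ℝ), ℝ⟯) : TangentConnection m M :=
  D.addOneForm fun x ↦ symProd (mvfderiv (𝓡 m) g x)

lemma perturb_apply (D : TangentConnection m M) (g : C^∞⟮𝓡 m, M; 𝓘(ℝ, ℝ), ℝ⟯)
    (X Y : Π x : M, TangentSpace (𝓡 m) x) (x : M) :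
    perturb D g Y x (X x) =
      D Y x (X x) + mvfderiv (𝓡 m) g x (X x) • Y x + mvfderiv (𝓡 m) g x (Y x) • X x := by
  rw [add_assoc, add_comm (mvfderiv (𝓡 m) g x (X x) • Y x)]
  rfl

/-- `D` and `D'` are strongly projectively equivalent: `D' = ^g D` for some smooth `g`. -/
def StronglyProjectivelyEquivalent (D D' : TangentConnection m M) : Prop :=
  ∃ g : C^∞⟮𝓡 m, M; 𝓘(ℝ, ℝ), ℝ⟯, SameConnection D' (perturb D g)

namespace AffineStructure

/-- Strongly projectively flat: strongly projectively equivalent to a flat connection. -/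
def IsStronglyProjectivelyFlat (A : AffineStructure m M) : Prop :=
  ∃ A₀ : AffineStructure m M, IsFlat A₀.conn ∧ StronglyProjectivelyEquivalent A.conn A₀.conn

lemma mdifferentiableAt_conn (A : AffineStructure m M) (Z : SmoothVF m M)
    {X : Π x : M, TangentSpace (𝓡 m) x} {x : M}
    (hX : VFDiffAt X x) : VFDiffAt (fun q ↦ A.conn Z q (X q)) x := by
  have hZ := A.smooth.contMDiff.contMDiff (σ := fun x ↦ Z x) (by
    simpa using! Z.contMDiff.contMDiffOn)
  have h1 := (hZ.contMDiffAt Filter.univ_mem).mdifferentiableAt (x := x) (by simp)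
  exact MDifferentiableAt.clm_bundle_apply h1 hX

/-- `R(X, Y) Z` at `x` is tensorial in `X`. -/
lemma tensorialAt_curvature (A : AffineStructure m M) (Y Z : SmoothVF m M) (x : M) :
    TensorialAt (𝓡 m) (EuclideanSpace ℝ (Fin m)) (fun X ↦ curvature A.conn X Y Z x) x where
  smul {f X} hf hX := by
    have h := A.conn.isCovariantDerivativeOn (s := Set.univ) |>.leibniz
      (A.mdifferentiableAt_conn Z hX) hf
    have e : (fun q ↦ A.conn Z q ((f • X) q)) = f • (fun q ↦ A.conn Z q (X q)) := by
      ext1 q; simp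
    simp only [curvature]
    rw [e, h, mlieBracket_smul_left hf hX]
    simp
    module
  add {X X'} hX hX' := by
    have h := A.conn.isCovariantDerivativeOn (s := Set.univ) |>.add
      (A.mdifferentiableAt_conn Z hX) (A.mdifferentiableAt_conn Z hX')
    have e : (fun q ↦ A.conn Z q ((X + X') q)) =
        (fun q ↦ A.conn Z q (X q)) + (fun q ↦ A.conn Z q (X' q)) := by
      ext1 q; simp
    simp only [curvature]
    rw [e, h, mlieBracket_add_left hX hX']
    simp
    module

/-- The Ricci tensor `ρ(Y, Z) = Tr (v ↦ R(v, Y) Z)` at the point `x`. -/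
def ricci (A : AffineStructure m M) (Y Z : SmoothVF m M) (x : M) : ℝ :=
  LinearMap.trace ℝ (TangentSpace (𝓡 m) x)
    (TensorialAt.mkHom (fun X ↦ curvature A.conn X Y Z x) x
      (A.tensorialAt_curvature Y Z x)).toLinearMap

/-- The symmetric Ricci tensor `ρ_s(Y, Z) = (ρ(Y, Z) + ρ(Z, Y)) / 2`. -/
def ricciSym (A : AffineStructure m M) (Y Z : SmoothVF m M) (x : M) : ℝ :=
  (A.ricci Y Z x + A.ricci Z Y x) / 2

/-- The Hessian `(H f)(X, Y) = X (Y f) - (∇_X Y) f` at the point `x`; in coordinates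
`∂_i ∂_j f - Γ_{ij}^k ∂_k f`. -/
def hessian (A : AffineStructure m M) (f : M → ℝ) (X Y : SmoothVF m M) (x : M) : ℝ :=
  mvfderiv (𝓡 m) (fun q ↦ mvfderiv (𝓡 m) f q (Y q)) x (X x)
    - mvfderiv (𝓡 m) f x (A.conn Y x (X x))

/-- The space `𝒬` of smooth solutions of `H f + (m - 1)⁻¹ f ρ_s = 0`. -/
def solutionSpace (A : AffineStructure m M) : Set (M → ℝ) :=
  {f | ContMDiff (𝓡 m) 𝓘(ℝ, ℝ) ∞ f ∧ ∀ (X Y : SmoothVF m M) (x : M),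
    A.hessian f X Y x + 1 / ((m : ℝ) - 1) * f x * A.ricciSym X Y x = 0}

end AffineStructure

/-- The pullback `(Ξ^* ∇)_X Y = Ξ_*⁻¹ (∇_{Ξ_* X} (Ξ_* Y))` of a connection by a diffeomorphism;
here `Ξ_* Y` is the pullback of `Y` by the inverse of `Ξ`. -/
def pullbackConnection (Ξ : M ≃ₘ⟮𝓡 m, 𝓡 m⟯ M) (D : TangentConnection m M) :
    TangentConnection m M where
  toFun Y x :=
    (mfderiv (𝓡 m) (𝓡 m) Ξ x).inverse ∘L
      (D (mpullback (𝓡 m) (𝓡 m) Ξ.symm Y) (Ξ x)) ∘L (mfderiv (𝓡 m) (𝓡 m) Ξ x)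
  isCovariantDerivativeOnUniv := by
    have hinv (q : M) : (mfderiv (𝓡 m) (𝓡 m) Ξ.symm q).IsInvertible :=
      ⟨Ξ.symm.mfderivToContinuousLinearEquiv (by simp) q, rfl⟩
    have hdiff {Y : Π x : M, TangentSpace (𝓡 m) x} {x : M} (hY : VFDiffAt Y x) :
        VFDiffAt (mpullback (𝓡 m) (𝓡 m) Ξ.symm Y) (Ξ x) := by
      refine MDifferentiableAt.mpullback_vectorField (n := ∞) ?_
        Ξ.symm.contMDiff.contMDiffAt (hinv _) ENat.LEInfty.out
      simpa using hY
    refine ⟨fun {Y Y' x} hY hY' _ ↦ ?_, fun {Y g x} hY hg _ ↦ ?_⟩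
    · rw [mpullback_add, D.isCovariantDerivativeOnUniv.add (hdiff hY) (hdiff hY')]
      ext v
      simp
    · have hΞ : MDifferentiableAt (𝓡 m) (𝓡 m) Ξ x := Ξ.contMDiff.mdifferentiable (by simp) x
      have hΞi : (mfderiv (𝓡 m) (𝓡 m) Ξ x).IsInvertible :=
        ⟨Ξ.mfderivToContinuousLinearEquiv (by simp) x, rfl⟩
      have hg' : MDifferentiableAt (𝓡 m) 𝓘(ℝ, ℝ) (g ∘ Ξ.symm) (Ξ x) := by
        refine MDifferentiableAt.comp (I' := 𝓡 m) (Ξ x) (by simpa using hg) ?_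
        exact Ξ.symm.contMDiff.mdifferentiable (by simp) _
      have hd (v : TangentSpace (𝓡 m) x) : mvfderiv (𝓡 m) (g ∘ Ξ.symm) (Ξ x)
          (mfderiv (𝓡 m) (𝓡 m) Ξ x v) = mvfderiv (𝓡 m) g x v := by
        rw [← mvfderiv_comp_apply x hg' hΞ]
        congr 2
        ext y
        simp
      have hY' : (mfderiv (𝓡 m) (𝓡 m) Ξ x).inverse
          (mpullback (𝓡 m) (𝓡 m) Ξ.symm Y (Ξ x)) = Y x := by
        have h := mpullbackWithin_comp_of_left (I := 𝓡 m) (I' := 𝓡 m) (I'' := 𝓡 m) (V := Y)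
          (g := Ξ.symm) (f := Ξ) (s := Set.univ) (t := Set.univ) (x₀ := x)
          hΞ.mdifferentiableWithinAt (Set.mapsTo_univ _ _) (uniqueMDiffWithinAt_univ _)
          (by simpa using hinv (Ξ x))
        have e : (Ξ.symm ∘ Ξ : M → M) = id := by
          ext y
          simp
        rw [e] at h
        simp only [mpullbackWithin_univ, mpullback_id] at h
        exact h.symm
      rw [mpullback_smul, D.isCovariantDerivativeOnUniv.leibniz (hdiff hY) hg']
      ext v
      simp [hd, hY']

end AffineGeometry

end

noncomputable section

namespace AffineGeometry

/-! A function with vanishing Hessian for a flat torsion-free connection is, together with its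
differential, a solution of an integrable linear total differential system, so that on a simply
connected manifold such affine functions realize every prescribed 1-jet at a point. If `∇` is
obtained from the flat connection `∇⁰` by the projective change with potential `h`, then its Ricci
tensor is `-(m - 1) (Hess⁰ h - dh ⊗ dh)`, and this makes `exp h * f` a solution of the
quasi-Einstein equation for every affine function `f` of `∇⁰`. The solutions that vanish at `x`
therefore realize every covector at `x`. Their Hessians vanish at `x`, which expresses `(∇_X Y) f`
at `x` as `X (Y f)` and determines `∇`. -/

section TotalDifferentialEquations

open Set Filter Topology MeasureTheory
open AffineMap (lineMap lineMap_apply_module' hasDerivAt_lineMap lineMap_continuous)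

variable {E F : Type*} [NormedAddCommGroup E] [NormedSpace ℝ E]
  [NormedAddCommGroup F] [NormedSpace ℝ F]

lemma continuous_fderiv_left_of_contDiff {G : E → ℝ → F}
    (hG : ContDiff ℝ 1 (Function.uncurry G)) :
    Continuous fun p : E × ℝ ↦ fderiv ℝ (G · p.2) p.1 := by
  have h : ContDiff ℝ 1 (Function.uncurry fun (p : E × ℝ) (x : E) ↦ G x p.2) :=
    hG.comp (g := Function.uncurry G) (f := fun q : (E × ℝ) × E ↦ (q.2, q.1.2)) (by fun_prop)
  exact (ContDiff.fderiv (n := 0) (m := 1) h contDiff_fst le_rfl).continuous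

lemma hasFDerivAt_intervalIntegral_of_contDiff [FiniteDimensional ℝ E] {G : E → ℝ → F}
    (hG : ContDiff ℝ 1 (Function.uncurry G)) (a b : ℝ) (x : E) :
    HasFDerivAt (fun x ↦ ∫ t in a..b, G x t) (∫ t in a..b, fderiv ℝ (G · t) x) x := by
  have hcont (x : E) : Continuous (G x) := hG.continuous.comp (by fun_prop : Continuous (x, ·))
  have hderiv := continuous_fderiv_left_of_contDiff hG
  obtain ⟨C, hC⟩ := ((isCompact_closedBall x 1).prod (isCompact_uIcc (a := a) (b := b)))
    |>.exists_bound_of_continuousOn hderiv.continuousOn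
  refine intervalIntegral.hasFDerivAt_integral_of_dominated_of_fderiv_le
    (F' := fun x t ↦ fderiv ℝ (G · t) x) (bound := fun _ ↦ C)
    (Metric.closedBall_mem_nhds x one_pos) (.of_forall fun x ↦ (hcont x).aestronglyMeasurable)
    ((hcont x).intervalIntegrable _ _)
    (hderiv.comp (by fun_prop : Continuous (x, ·))).aestronglyMeasurable
    (.of_forall fun t ht z hz ↦ hC (z, t) ⟨hz, uIoc_subset_uIcc ht⟩)
    intervalIntegrable_const (.of_forall fun t _ z _ ↦ ?_)
  have : ContDiff ℝ 1 (G · t) := hG.comp (f := fun x : E ↦ (x, t)) (by fun_prop)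
  exact (this.differentiable one_ne_zero z).hasFDerivAt

lemma contDiff_intervalIntegral [FiniteDimensional ℝ E] {G : E → ℝ → F}
    (hG : ContDiff ℝ 1 (Function.uncurry G)) (a b : ℝ) :
    ContDiff ℝ 1 fun x ↦ ∫ t in a..b, G x t := by
  have h := hasFDerivAt_intervalIntegral_of_contDiff hG a b
  refine contDiff_one_iff_fderiv.2 ⟨fun x ↦ (h x).differentiableAt, ?_⟩
  rw [funext fun x ↦ (h x).fderiv]
  exact intervalIntegral.continuous_parametric_intervalIntegral_of_continuous' (f := fun x t ↦ _)
    (continuous_fderiv_left_of_contDiff hG) a b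

/-- The exterior derivative `dα(v, w) = (D_v α) w - (D_w α) v` of a 1-form on a normed space, as a
bilinear map. -/
def exteriorDeriv (α : E → E →L[ℝ] F) (x : E) : E →L[ℝ] E →L[ℝ] F :=
  fderiv ℝ α x - (fderiv ℝ α x).flip

lemma contDiff_segment_integrand {α : E → E →L[ℝ] F} (hα : ContDiff ℝ 1 α) (y : E) :
    ContDiff ℝ 1 (Function.uncurry fun (x : E) (t : ℝ) ↦ α (lineMap y x t) (x - y)) := by
  have hz : ContDiff ℝ 1 fun p : E × ℝ ↦ lineMap y p.1 p.2 := by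
    simp only [lineMap_apply_module']
    fun_prop
  exact (hα.comp hz).clm_apply (contDiff_fst.sub contDiff_const)

lemma contDiff_curveIntegral_segment [FiniteDimensional ℝ E] {α : E → E →L[ℝ] F}
    (hα : ContDiff ℝ 1 α) (y : E) : ContDiff ℝ 1 fun x ↦ ∫ᶜ z in .segment y x, α z := by
  simp only [curveIntegral_segment]
  exact contDiff_intervalIntegral (contDiff_segment_integrand hα y) 0 1

lemma fderiv_segment_integrand {α : E → E →L[ℝ] F} (hα : Differentiable ℝ α) (y x : E) (t : ℝ) :
    fderiv ℝ (fun x ↦ α (lineMap y x t) (x - y)) x =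
      α (lineMap y x t) + t • (fderiv ℝ α (lineMap y x t)).flip (x - y) := by
  have hline : HasFDerivAt (fun x ↦ lineMap y x t) (t • ContinuousLinearMap.id ℝ E) x := by
    simp only [lineMap_apply_module']
    exact (((hasFDerivAt_id x).sub_const y).const_smul t).add_const y
  have hαline := HasFDerivAt.comp (g := α) x (hα (lineMap y x t)).hasFDerivAt hline
  refine ((hαline.clm_apply ((hasFDerivAt_id x).sub_const y)).congr_fderiv ?_).fderiv
  ext v
  simp

lemma hasDerivAt_smul_comp_lineMap {G : Type*} [NormedAddCommGroup G] [NormedSpace ℝ G]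
    {α : E → G} (hα : Differentiable ℝ α) (y x : E) (t : ℝ) :
    HasDerivAt (fun t : ℝ ↦ t • α (lineMap y x t))
      (α (lineMap y x t) + t • fderiv ℝ α (lineMap y x t) (x - y)) t := by
  have hαline : HasDerivAt (fun t : ℝ ↦ α (lineMap y x t))
      (fderiv ℝ α (lineMap y x t) (x - y)) t :=
    (hα _).hasFDerivAt.comp_hasDerivAt t hasDerivAt_lineMap
  exact ((hasDerivAt_id t).smul hαline).congr_deriv (by simp [add_comm])

-- The homotopy formula `d ∘ I + I ∘ d = id` for the radial homotopy `I` in degree one.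
lemma hasFDerivAt_curveIntegral_segment [FiniteDimensional ℝ E] [CompleteSpace F]
    {α : E → E →L[ℝ] F} (hα : ContDiff ℝ 1 α) (y x : E) :
    HasFDerivAt (fun x ↦ ∫ᶜ z in .segment y x, α z)
      (α x - ∫ t in (0 : ℝ)..1, t • exteriorDeriv α (lineMap y x t) (x - y)) x := by
  have hd : Differentiable ℝ α := hα.differentiable one_ne_zero
  have hz : Continuous fun t : ℝ ↦ lineMap y x t := lineMap_continuous
  have hαc : Continuous fun t : ℝ ↦ α (lineMap y x t) := hα.continuous.comp hz
  have hα'c : Continuous fun t : ℝ ↦ fderiv ℝ α (lineMap y x t) :=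
    (hα.continuous_fderiv one_ne_zero).comp hz
  have hradial : Continuous fun t : ℝ ↦
      α (lineMap y x t) + t • fderiv ℝ α (lineMap y x t) (x - y) :=
    hαc.add (continuous_id.smul (hα'c.clm_apply continuous_const))
  have hext : Continuous fun t : ℝ ↦ t • exteriorDeriv α (lineMap y x t) (x - y) := by
    have hflip : Continuous fun t : ℝ ↦ (fderiv ℝ α (lineMap y x t)).flip :=
      (ContinuousLinearMap.flipₗᵢ ℝ E E F).continuous.comp hα'c
    exact continuous_id.smul
      ((hα'c.clm_apply continuous_const).sub (hflip.clm_apply continuous_const))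
  have hftc : ∫ t in (0 : ℝ)..1, (α (lineMap y x t) + t • fderiv ℝ α (lineMap y x t) (x - y)) =
      α x := by
    rw [intervalIntegral.integral_eq_sub_of_hasDerivAt
      (fun t _ ↦ hasDerivAt_smul_comp_lineMap hd y x t) (hradial.intervalIntegrable _ _)]
    simp
  simp only [curveIntegral_segment]
  refine (hasFDerivAt_intervalIntegral_of_contDiff (contDiff_segment_integrand hα y) 0 1 x)
    |>.congr_fderiv ?_
  rw [← hftc, ← intervalIntegral.integral_sub (hradial.intervalIntegrable _ _)
    (hext.intervalIntegrable _ _)]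
  refine intervalIntegral.integral_congr fun t _ ↦ ?_
  simp only [fderiv_segment_integrand hd, exteriorDeriv, sub_apply]
  module

lemma norm_fderiv_curveIntegral_segment_sub_le [FiniteDimensional ℝ E] [CompleteSpace F]
    {α : E → E →L[ℝ] F} (hα : ContDiff ℝ 1 α) {y x : E} {C : ℝ}
    (hC : ∀ z ∈ segment ℝ y x, ‖exteriorDeriv α z‖ ≤ C) :
    ‖fderiv ℝ (fun x ↦ ∫ᶜ z in .segment y x, α z) x - α x‖ ≤ C * ‖x - y‖ := by
  rw [(hasFDerivAt_curveIntegral_segment hα y x).fderiv, sub_sub_cancel_left, norm_neg]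
  refine (intervalIntegral.norm_integral_le_of_norm_le_const (C := C * ‖x - y‖)
    fun t ht ↦ ?_).trans_eq (by simp)
  rw [uIoc_of_le zero_le_one] at ht
  have hz := hC _ (lineMap_mem_segment ℝ y x (Ioc_subset_Icc_self ht))
  rw [norm_smul, Real.norm_of_nonneg ht.1.le]
  exact (mul_le_of_le_one_left (norm_nonneg _) ht.2).trans
    ((exteriorDeriv α _).le_of_opNorm_le hz _)

/-- `u` solves the linear total differential equation `Du = A(x) u` on `s`. -/
def IsTotalSolutionOn (A : E → F →L[ℝ] E →L[ℝ] F) (u : E → F) (s : Set E) : Prop :=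
  ∀ x ∈ s, HasFDerivAt u (A x (u x)) x

/-- The Frobenius integrability condition at `x` of the total differential equation `Du = A(x) u`:
the second derivative prescribed by the equation is symmetric. -/
def IsIntegrableAt (A : E → F →L[ℝ] E →L[ℝ] F) (x : E) : Prop :=
  ∀ v w c, fderiv ℝ A x v c w + A x (A x c v) w = fderiv ℝ A x w c v + A x (A x c w) v

/-- The defect by which `w` fails to solve `Du = A(x) u`. -/
def defect (A : E → F →L[ℝ] E →L[ℝ] F) (w : E → F) (x : E) : E →L[ℝ] F :=
  fderiv ℝ w x - A x (w x)

/-- One step of the Picard iteration, along the rays issued from `y`, for `Du = A(x) u` with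
initial value `u y = c`. -/
def picardStep (A : E → F →L[ℝ] E →L[ℝ] F) (y : E) (c : F) (w : E → F) (x : E) : F :=
  c + ∫ᶜ z in .segment y x, A z (w z)

variable {A : E → F →L[ℝ] E →L[ℝ] F}

lemma contDiff_picardStep [FiniteDimensional ℝ E] (hA : ContDiff ℝ 1 A) (y : E) (c : F)
    {w : E → F} (hw : ContDiff ℝ 1 w) : ContDiff ℝ 1 (picardStep A y c w) :=
  contDiff_const.add (contDiff_curveIntegral_segment (hA.clm_apply hw) y)

lemma norm_picardStep_sub_le (hA : Continuous A) (y : E) (c : F) {w w' : E → F}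
    (hw : Continuous w) (hw' : Continuous w') {x : E} {K δ : ℝ}
    (hK : ∀ z ∈ segment ℝ y x, ‖A z‖ ≤ K) (hδ : ∀ z ∈ segment ℝ y x, ‖w z - w' z‖ ≤ δ) :
    ‖picardStep A y c w x - picardStep A y c w' x‖ ≤ K * δ * ‖x - y‖ := by
  have hint {w : E → F} (hw : Continuous w) :
      CurveIntegrable (fun z ↦ A z (w z)) (.segment y x) := by
    rw [curveIntegrable_segment]
    exact Continuous.intervalIntegrable (((hA.clm_apply hw).comp lineMap_continuous).clm_apply
      continuous_const) _ _
  rw [picardStep, picardStep, add_sub_add_left_eq_sub, ← curveIntegral_fun_sub (hint hw) (hint hw')]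
  refine norm_curveIntegral_segment_le fun z hz ↦ ?_
  rw [← map_sub]
  exact (A z).le_of_opNorm_le_of_le (hK z hz) (hδ z hz)

-- Integrability makes the exterior derivative of the Picard integrand vanish on solutions.
lemma exteriorDeriv_clm_apply {w : E → F} {x : E} (hA : DifferentiableAt ℝ A x)
    (hw : DifferentiableAt ℝ w x) (hint : IsIntegrableAt A x) (v v' : E) :
    exteriorDeriv (fun z ↦ A z (w z)) x v v' =
      A x (defect A w x v) v' - A x (defect A w x v') v := by
  have h := sub_eq_zero.2 (hint v v' (w x))
  rw [← sub_eq_zero, ← h]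
  simp only [exteriorDeriv, (hA.hasFDerivAt.clm_apply hw.hasFDerivAt).fderiv, defect, sub_apply,
    add_apply, ContinuousLinearMap.flip_apply, ContinuousLinearMap.comp_apply, map_sub]
  abel

lemma norm_exteriorDeriv_clm_apply_le {w : E → F} {x : E} (hA : DifferentiableAt ℝ A x)
    (hw : DifferentiableAt ℝ w x) (hint : IsIntegrableAt A x) :
    ‖exteriorDeriv (fun z ↦ A z (w z)) x‖ ≤ 2 * (‖A x‖ * ‖defect A w x‖) := by
  refine ContinuousLinearMap.opNorm_le_bound₂ _ (by positivity) fun v v' ↦ ?_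
  rw [exteriorDeriv_clm_apply hA hw hint]
  have h (v v' : E) : ‖A x (defect A w x v) v'‖ ≤ ‖A x‖ * ‖defect A w x‖ * ‖v‖ * ‖v'‖ :=
    calc ‖A x (defect A w x v) v'‖ ≤ ‖A x‖ * ‖defect A w x v‖ * ‖v'‖ := (A x).le_opNorm₂ _ _
      _ ≤ ‖A x‖ * (‖defect A w x‖ * ‖v‖) * ‖v'‖ := by gcongr; exact (defect A w x).le_opNorm v
      _ = _ := by ring
  linarith [norm_sub_le (A x (defect A w x v) v') (A x (defect A w x v') v), h v v', h v' v]

lemma norm_defect_picardStep_le [FiniteDimensional ℝ E] [CompleteSpace F] (hA : ContDiff ℝ 1 A)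
    (y : E) (c : F) {w : E → F} (hw : ContDiff ℝ 1 w) {x : E} {K δ ε : ℝ}
    (hint : ∀ z ∈ segment ℝ y x, IsIntegrableAt A z) (hK : ∀ z ∈ segment ℝ y x, ‖A z‖ ≤ K)
    (hδ : ∀ z ∈ segment ℝ y x, ‖defect A w z‖ ≤ δ) (hε : ‖picardStep A y c w x - w x‖ ≤ ε) :
    ‖defect A (picardStep A y c w) x‖ ≤ 2 * (K * δ) * ‖x - y‖ + K * ε := by
  have hK0 : 0 ≤ K := (norm_nonneg (A x)).trans (hK x (right_mem_segment ℝ y x))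
  have hext (z) (hz : z ∈ segment ℝ y x) :
      ‖exteriorDeriv (fun z ↦ A z (w z)) z‖ ≤ 2 * (K * δ) := by
    refine (norm_exteriorDeriv_clm_apply_le (hA.differentiable one_ne_zero z)
      (hw.differentiable one_ne_zero z) (hint z hz)).trans ?_
    gcongr
    exacts [hK z hz, hδ z hz]
  have hfderiv : fderiv ℝ (picardStep A y c w) x =
      fderiv ℝ (fun x ↦ ∫ᶜ z in .segment y x, A z (w z)) x := fderiv_const_add c
  calc ‖defect A (picardStep A y c w) x‖
      = ‖(fderiv ℝ (fun x ↦ ∫ᶜ z in .segment y x, A z (w z)) x - A x (w x))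
          - A x (picardStep A y c w x - w x)‖ := by
        rw [defect, hfderiv, map_sub]
        congr 1
        abel
    _ ≤ 2 * (K * δ) * ‖x - y‖ + K * ε := by
        refine (norm_sub_le _ _).trans (add_le_add
          (norm_fderiv_curveIntegral_segment_sub_le (hA.clm_apply hw) hext) ?_)
        exact (A x).le_of_opNorm_le_of_le (hK x (right_mem_segment ℝ y x)) hε

/-- The Picard iterates for `Du = A(x) u`, `u y = c`, starting from the zero function. -/
def picardIterate (A : E → F →L[ℝ] E →L[ℝ] F) (y : E) (c : F) (n : ℕ) : E → F :=
  (picardStep A y c)^[n] 0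

lemma picardIterate_succ (A : E → F →L[ℝ] E →L[ℝ] F) (y : E) (c : F) (n : ℕ) :
    picardIterate A y c (n + 1) = picardStep A y c (picardIterate A y c n) :=
  Function.iterate_succ_apply' _ _ _

lemma picardIterate_succ_self (A : E → F →L[ℝ] E →L[ℝ] F) (y : E) (c : F) (n : ℕ) :
    picardIterate A y c (n + 1) y = c := by
  simp [picardIterate_succ, picardStep]

lemma contDiff_picardIterate [FiniteDimensional ℝ E] (hA : ContDiff ℝ 1 A) (y : E) (c : F)
    (n : ℕ) : ContDiff ℝ 1 (picardIterate A y c n) := by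
  induction n with
  | zero => exact contDiff_const
  | succ n ih =>
    rw [picardIterate_succ]
    exact contDiff_picardStep hA y c ih

lemma isTotalSolutionOn_of_tendstoUniformlyOn {s : Set E} (hs : IsOpen s) {K : ℝ}
    (hK : ∀ x ∈ s, ‖A x‖ ≤ K) {W : ℕ → E → F} {u : E → F} (hW : ∀ n, Differentiable ℝ (W n))
    (hu : TendstoUniformlyOn W u atTop s)
    (hdefect : TendstoUniformlyOn (fun n ↦ defect A (W n)) 0 atTop s) :
    IsTotalSolutionOn A u s := by
  have hAW : TendstoUniformlyOn (fun n x ↦ A x (W n x)) (fun x ↦ A x (u x)) atTop s := by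
    rw [Metric.tendstoUniformlyOn_iff] at hu ⊢
    intro ε hε
    filter_upwards [hu (ε / (|K| + 1)) (by positivity)] with n hn x hx
    rw [dist_eq_norm, ← map_sub]
    calc ‖A x (u x - W n x)‖ ≤ (|K| + 1) * ‖u x - W n x‖ :=
          (A x).le_of_opNorm_le ((hK x hx).trans ((le_abs_self K).trans (by linarith))) _
      _ < (|K| + 1) * (ε / (|K| + 1)) := by
          gcongr
          simpa only [dist_eq_norm] using hn x hx
      _ = ε := by field_simp
  have hfderiv : TendstoUniformlyOn (fun n ↦ fderiv ℝ (W n)) (fun x ↦ A x (u x)) atTop s := by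
    refine ((hdefect.add hAW).congr (.of_forall fun n x _ ↦ ?_)).congr_right fun x _ ↦ ?_
    · exact sub_add_cancel _ _
    · exact zero_add _
  exact fun x hx ↦ hasFDerivAt_of_tendstoUniformlyOn hs hfderiv
    (fun n x _ ↦ (hW n x).hasFDerivAt) (fun x hx ↦ hu.tendsto_at hx) hx

section SmallBall

variable {y : E} {R K : ℝ}

lemma segment_subset_ball {x : E} (hx : x ∈ Metric.ball y R) :
    segment ℝ y x ⊆ Metric.ball y R :=
  (convex_ball y R).segment_subset
    (Metric.mem_ball_self (dist_nonneg.trans_lt (Metric.mem_ball.1 hx))) hx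

variable [FiniteDimensional ℝ E]

lemma norm_picardIterate_succ_sub_le (hA : ContDiff ℝ 1 A)
    (hK : ∀ x ∈ Metric.ball y R, ‖A x‖ ≤ K) (hKR : K * R ≤ 1 / 8) (c : F) (n : ℕ) :
    ∀ x ∈ Metric.ball y R,
      ‖picardIterate A y c (n + 1) x - picardIterate A y c n x‖ ≤ ‖c‖ * (1 / 2) ^ n := by
  induction n with
  | zero =>
    intro x _
    simp [picardIterate, picardStep]
  | succ n ih =>
    intro x hx
    have hseg := segment_subset_ball hx
    have hK0 : 0 ≤ K := (norm_nonneg (A x)).trans (hK x hx)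
    rw [picardIterate_succ A y c (n + 1)]
    nth_rewrite 2 [picardIterate_succ]
    refine (norm_picardStep_sub_le hA.continuous y c (contDiff_picardIterate hA y c _).continuous
      (contDiff_picardIterate hA y c _).continuous (fun z hz ↦ hK z (hseg hz))
      (fun z hz ↦ ih z (hseg hz))).trans ?_
    calc K * (‖c‖ * (1 / 2) ^ n) * ‖x - y‖ ≤ K * (‖c‖ * (1 / 2) ^ n) * R := by
          gcongr
          exact (mem_ball_iff_norm.1 hx).le
      _ = K * R * (‖c‖ * (1 / 2) ^ n) := by ring
      _ ≤ 1 / 8 * (‖c‖ * (1 / 2) ^ n) := by gcongr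
      _ ≤ 1 / 2 * (‖c‖ * (1 / 2) ^ n) := by gcongr; norm_num
      _ = ‖c‖ * (1 / 2) ^ (n + 1) := by ring

lemma norm_defect_picardIterate_le [CompleteSpace F] (hA : ContDiff ℝ 1 A)
    (hint : ∀ x ∈ Metric.ball y R, IsIntegrableAt A x)
    (hK : ∀ x ∈ Metric.ball y R, ‖A x‖ ≤ K) (hKR : K * R ≤ 1 / 8) (c : F) (n : ℕ) :
    ∀ x ∈ Metric.ball y R, ‖defect A (picardIterate A y c n) x‖ ≤ 4 * (K * ‖c‖) * (1 / 2) ^ n := by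
  induction n with
  | zero =>
    intro x hx
    have hK0 : 0 ≤ K := (norm_nonneg (A x)).trans (hK x hx)
    simp only [picardIterate, defect, Function.iterate_zero, id, Pi.zero_apply, map_zero,
      fderiv_zero, sub_zero, norm_zero]
    positivity
  | succ n ih =>
    intro x hx
    have hseg := segment_subset_ball hx
    have hK0 : 0 ≤ K := (norm_nonneg (A x)).trans (hK x hx)
    have hstep := norm_picardIterate_succ_sub_le hA hK hKR c n x hx
    rw [picardIterate_succ] at hstep ⊢
    refine (norm_defect_picardStep_le hA y c (contDiff_picardIterate hA y c n)
      (fun z hz ↦ hint z (hseg hz)) (fun z hz ↦ hK z (hseg hz)) (fun z hz ↦ ih z (hseg hz))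
      hstep).trans ?_
    set a := K * ‖c‖ * (1 / 2) ^ n
    calc 2 * (K * (4 * (K * ‖c‖) * (1 / 2) ^ n)) * ‖x - y‖ + K * (‖c‖ * (1 / 2) ^ n)
        ≤ 2 * (K * (4 * (K * ‖c‖) * (1 / 2) ^ n)) * R + K * (‖c‖ * (1 / 2) ^ n) := by
          gcongr
          exact (mem_ball_iff_norm.1 hx).le
      _ = 8 * (K * R) * a + a := by ring
      _ ≤ 8 * (1 / 8) * a + a := by gcongr
      _ = 4 * (K * ‖c‖) * (1 / 2) ^ (n + 1) := by ring

lemma exists_tendstoUniformlyOn_picardIterate [CompleteSpace F] (hA : ContDiff ℝ 1 A)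
    (hK : ∀ x ∈ Metric.ball y R, ‖A x‖ ≤ K) (hKR : K * R ≤ 1 / 8) (c : F) :
    ∃ u, TendstoUniformlyOn (picardIterate A y c) u atTop (Metric.ball y R) := by
  have h := tendstoUniformlyOn_tsum_nat (summable_geometric_two.mul_left ‖c‖)
    (norm_picardIterate_succ_sub_le hA hK hKR c)
  refine ⟨_, h.congr (.of_forall fun n x _ ↦ ?_)⟩
  simp only [Finset.sum_range_sub fun n ↦ picardIterate A y c n x]
  exact sub_zero _

lemma exists_isTotalSolutionOn_ball [CompleteSpace F] (hA : ContDiff ℝ 1 A) (hR : 0 < R)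
    (hint : ∀ x ∈ Metric.ball y R, IsIntegrableAt A x)
    (hK : ∀ x ∈ Metric.ball y R, ‖A x‖ ≤ K) (hKR : K * R ≤ 1 / 8) (c : F) :
    ∃ u, u y = c ∧ IsTotalSolutionOn A u (Metric.ball y R) := by
  obtain ⟨u, hu⟩ := exists_tendstoUniformlyOn_picardIterate hA hK hKR c
  have huy : Tendsto (picardIterate A y c · y) atTop (𝓝 c) := by
    refine (tendsto_add_atTop_iff_nat 1).1 ?_
    simp only [picardIterate_succ_self, tendsto_const_nhds]
  have hdefect : TendstoUniformlyOn (fun n ↦ defect A (picardIterate A y c n)) 0 atTop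
      (Metric.ball y R) := by
    have hgeom : Tendsto (fun n : ℕ ↦ 4 * (K * ‖c‖) * (1 / 2 : ℝ) ^ n) atTop (𝓝 0) := by
      simpa using (tendsto_pow_atTop_nhds_zero_of_lt_one (r := (1 / 2 : ℝ)) (by norm_num)
        (by norm_num)).const_mul (4 * (K * ‖c‖))
    refine Metric.tendstoUniformlyOn_iff.2 fun ε hε ↦ ?_
    filter_upwards [hgeom.eventually_lt_const hε] with n hn x hx
    rw [Pi.zero_apply, dist_zero_left]
    exact (norm_defect_picardIterate_le hA hint hK hKR c n x hx).trans_lt hn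
  exact ⟨u, tendsto_nhds_unique (hu.tendsto_at (Metric.mem_ball_self hR)) huy,
    isTotalSolutionOn_of_tendstoUniformlyOn Metric.isOpen_ball hK
      (fun n ↦ (contDiff_picardIterate hA y c n).differentiable one_ne_zero) hu hdefect⟩

end SmallBall

lemma IsTotalSolutionOn.sub {u u' : E → F} {s : Set E} (hu : IsTotalSolutionOn A u s)
    (hu' : IsTotalSolutionOn A u' s) : IsTotalSolutionOn A (u - u') s := fun x hx ↦
  ((hu x hx).sub (hu' x hx)).congr_fderiv (map_sub (A x) (u x) (u' x)).symm

lemma IsTotalSolutionOn.eqOn_zero {s : Set E} (hs : Convex ℝ s) (hA : ContinuousOn A s)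
    {u : E → F} (hu : IsTotalSolutionOn A u s) {y : E} (hy : y ∈ s) (huy : u y = 0) :
    EqOn u 0 s := by
  intro x hx
  have hline (t : ℝ) (ht : t ∈ Icc (0 : ℝ) 1) : lineMap y x t ∈ s :=
    hs.segment_subset hy hx (lineMap_mem_segment ℝ y x ht)
  have hAline : ContinuousOn (fun t : ℝ ↦ (A (lineMap y x t)).flip (x - y)) (Icc 0 1) :=
    ((ContinuousLinearMap.flipₗᵢ ℝ F E F).continuous.comp_continuousOn
      (hA.comp lineMap_continuous.continuousOn hline)).clm_apply continuousOn_const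
  have hderiv (t : ℝ) (ht : t ∈ Icc (0 : ℝ) 1) :
      HasDerivAt (fun t : ℝ ↦ u (lineMap y x t))
        ((A (lineMap y x t)).flip (x - y) (u (lineMap y x t))) t :=
    (hu _ (hline t ht)).comp_hasDerivAt t hasDerivAt_lineMap
  obtain ⟨C, hC⟩ := isCompact_Icc.exists_bound_of_continuousOn hAline
  have hx0 := eq_zero_of_abs_deriv_le_mul_abs_self_of_eq_zero_right
    (f := fun t : ℝ ↦ u (lineMap y x t)) (K := C) (a := 0) (b := 1)
    (fun t ht ↦ (hderiv t ht).continuousAt.continuousWithinAt)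
    (fun t ht ↦ (hderiv t (Ico_subset_Icc_self ht)).hasDerivWithinAt)
    (by simpa using huy)
    (fun t ht ↦ ContinuousLinearMap.le_of_opNorm_le _ (hC t (Ico_subset_Icc_self ht)) _)
    1 (by simp)
  simpa using hx0

lemma IsTotalSolutionOn.eqOn {s : Set E} (hs : Convex ℝ s) (hA : ContinuousOn A s)
    {u u' : E → F} (hu : IsTotalSolutionOn A u s) (hu' : IsTotalSolutionOn A u' s)
    {y : E} (hy : y ∈ s) (huy : u y = u' y) : EqOn u u' s := fun _ hx ↦
  sub_eq_zero.1 ((hu.sub hu').eqOn_zero hs hA hy (sub_eq_zero.2 huy) hx)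

lemma IsTotalSolutionOn.contDiffOn {s : Set E} (hs : IsOpen s) (hA : ContDiffOn ℝ ∞ A s)
    {u : E → F} (hu : IsTotalSolutionOn A u s) : ContDiffOn ℝ ∞ u s := by
  refine contDiffOn_infty.2 fun n ↦ ?_
  induction n with
  | zero => exact contDiffOn_zero.2 fun x hx ↦ (hu x hx).continuousAt.continuousWithinAt
  | succ n ih =>
    refine (contDiffOn_succ_iff_fderiv_of_isOpen (n := n) hs).2
      ⟨fun x hx ↦ (hu x hx).differentiableAt.differentiableWithinAt, nofun, ?_⟩
    exact ((contDiffOn_infty.1 hA n).clm_apply ih).congr fun x hx ↦ (hu x hx).fderiv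

lemma exists_contDiff_eqOn_ball [FiniteDimensional ℝ E] {U : Set E} {f : E → F}
    (hf : ContDiffOn ℝ 1 f U) {x₀ : E} (hx₀ : U ∈ 𝓝 x₀) :
    ∃ ρ > 0, Metric.ball x₀ ρ ⊆ U ∧ ∃ f' : E → F, ContDiff ℝ 1 f' ∧
      EqOn f' f (Metric.ball x₀ ρ) := by
  obtain ⟨ρ, hρ, hρU⟩ := Metric.nhds_basis_closedBall.mem_iff.1 (interior_mem_nhds.2 hx₀)
  let χ : ContDiffBump x₀ := ⟨ρ / 2, ρ, by positivity, by linarith⟩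
  refine ⟨ρ / 2, by positivity, ?_, fun x ↦ χ x • f x, contDiff_iff_contDiffAt.2 fun x ↦ ?_,
    fun x hx ↦ ?_⟩
  · exact (Metric.ball_subset_closedBall.trans (Metric.closedBall_subset_closedBall
      (by linarith))).trans (hρU.trans interior_subset)
  · by_cases hx : x ∈ Metric.closedBall x₀ ρ
    · exact χ.contDiffAt.smul (hf.contDiffAt (mem_interior_iff_mem_nhds.1 (hρU hx)))
    · refine (contDiffAt_const (c := (0 : F))).congr_of_eventuallyEq ?_
      filter_upwards [Metric.isClosed_closedBall.isOpen_compl.mem_nhds hx] with z hz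
      rw [mem_compl_iff, Metric.mem_closedBall, not_le] at hz
      rw [χ.zero_of_le_dist hz.le, zero_smul]
  · simp only [χ.one_of_mem_closedBall (Metric.ball_subset_closedBall hx), one_smul]

theorem exists_ball_forall_isTotalSolutionOn [FiniteDimensional ℝ E] [CompleteSpace F]
    {U : Set E} (hA : ContDiffOn ℝ 1 A U) (hint : ∀ x ∈ U, IsIntegrableAt A x) {x₀ : E}
    (hx₀ : U ∈ 𝓝 x₀) :
    ∃ r > 0, Metric.ball x₀ r ⊆ U ∧
      ∀ y ∈ Metric.ball x₀ r, ∀ c, ∃ u, u y = c ∧ IsTotalSolutionOn A u (Metric.ball x₀ r) := by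
  obtain ⟨ρ, hρ, hρU, A', hA', hAA'⟩ := exists_contDiff_eqOn_ball hA hx₀
  have hint' : ∀ x ∈ Metric.ball x₀ ρ, IsIntegrableAt A' x := by
    intro x hx v w c
    rw [(hAA'.eventuallyEq_of_mem (Metric.isOpen_ball.mem_nhds hx)).fderiv_eq, hAA' hx]
    exact hint x (hρU hx) v w c
  obtain ⟨K, hK⟩ : ∃ K, ∀ x ∈ Metric.closedBall x₀ ρ, ‖A' x‖ ≤ K :=
    let _ : NormedAddCommGroup (F →L[ℝ] E →L[ℝ] F) := ContinuousLinearMap.toNormedAddCommGroup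
    (isCompact_closedBall x₀ ρ).exists_bound_of_continuousOn hA'.continuous.continuousOn
  obtain ⟨r, hr, hrρ, hKr⟩ : ∃ r > 0, 3 * r ≤ ρ ∧ K * (2 * r) ≤ 1 / 8 := by
    have hsmall : ∀ᶠ r in 𝓝 (0 : ℝ), 3 * r < ρ ∧ K * (2 * r) < 1 / 8 :=
      ((by fun_prop : Continuous fun r : ℝ ↦ 3 * r).tendsto' 0 0 (by simp)
        |>.eventually_lt_const hρ).and
      ((by fun_prop : Continuous fun r : ℝ ↦ K * (2 * r)).tendsto' 0 0 (by simp)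
        |>.eventually_lt_const (by norm_num))
    obtain ⟨r, hr, hr0⟩ := ((hsmall.filter_mono nhdsWithin_le_nhds).and
      (self_mem_nhdsWithin (s := Ioi 0))).exists
    exact ⟨r, hr0, hr.1.le, hr.2.le⟩
  refine ⟨r, hr, (Metric.ball_subset_ball (by linarith)).trans hρU, fun y hy c ↦ ?_⟩
  rw [Metric.mem_ball] at hy
  have hyρ : Metric.ball y (2 * r) ⊆ Metric.ball x₀ ρ := Metric.ball_subset_ball' (by linarith)
  have hry : Metric.ball x₀ r ⊆ Metric.ball y (2 * r) :=
    Metric.ball_subset_ball' (by rw [dist_comm]; linarith)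
  obtain ⟨u, huy, hu⟩ := exists_isTotalSolutionOn_ball hA' (by positivity)
    (fun x hx ↦ hint' x (hyρ hx)) (fun x hx ↦ hK x (Metric.ball_subset_closedBall (hyρ hx))) hKr c
  refine ⟨u, huy, fun x hx ↦ ?_⟩
  rw [← hAA' (hyρ (hry hx))]
  exact hu x (hry hx)

lemma exists_ball_bijective_isTotalSolutionOn [FiniteDimensional ℝ E] [CompleteSpace F]
    {U : Set E} (hA : ContDiffOn ℝ 1 A U) (hint : ∀ x ∈ U, IsIntegrableAt A x) {x₀ : E}
    (hx₀ : U ∈ 𝓝 x₀) :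
    ∃ r > 0, Metric.ball x₀ r ⊆ U ∧ ∃ u : F → E → F,
      (∀ c, IsTotalSolutionOn A (u c) (Metric.ball x₀ r)) ∧
        ∀ y ∈ Metric.ball x₀ r, Function.Bijective fun c ↦ u c y := by
  obtain ⟨r, hr, hrU, hsol⟩ := exists_ball_forall_isTotalSolutionOn hA hint hx₀
  have hx₀r : x₀ ∈ Metric.ball x₀ r := Metric.mem_ball_self hr
  have hconv := convex_ball x₀ r
  have hAr : ContinuousOn A (Metric.ball x₀ r) := hA.continuousOn.mono hrU
  choose u hu₀ hu using hsol x₀ hx₀r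
  refine ⟨r, hr, hrU, u, hu, fun y hy ↦ ⟨fun c d hcd ↦ ?_, fun d ↦ ?_⟩⟩
  · rw [← hu₀ c, ← hu₀ d, (hu c).eqOn hconv hAr (hu d) hy hcd hx₀r]
  · obtain ⟨w, hw, hwsol⟩ := hsol y hy d
    refine ⟨w x₀, ?_⟩
    rw [← hw]
    exact (hu _).eqOn hconv hAr hwsol hx₀r (hu₀ _) hy

end TotalDifferentialEquations

section LocalSystems

open Set Filter Topology

variable {X J : Type*} {Φ : X → Type*}

/-- The parameter at `j` of the value at `x` of the local section at `i` with parameter `c`, when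
the local sections near `i` are `x ↦ T i x c` with parameter `c : J`. -/
def transition (T : X → (x : X) → J → Φ x) (i j x : X) (c : J) : J :=
  @Function.invFun _ _ ⟨c⟩ (T j x) (T i x c)

variable {V : X → Set X} {T : X → (x : X) → J → Φ x}

lemma apply_transition (hT : ∀ i, ∀ x ∈ V i, (T i x).Bijective) {j x : X} (hx : x ∈ V j) (i : X)
    (c : J) : T j x (transition T i j x c) = T i x c :=
  @Function.invFun_eq _ _ ⟨c⟩ _ _ ((hT j x hx).surjective _)

variable [TopologicalSpace X]

lemma eventually_transition_eq (hV : ∀ i, IsOpen (V i)) (hT : ∀ i, ∀ x ∈ V i, (T i x).Bijective)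
    (hcont : ∀ i j, ∀ x ∈ V i ∩ V j, ∀ c d, T i x c = T j x d → ∀ᶠ y in 𝓝 x, T i y c = T j y d)
    {i j x : X} (hx : x ∈ V i ∩ V j) (c : J) :
    ∀ᶠ y in 𝓝 x, transition T i j y c = transition T i j x c := by
  filter_upwards [hcont i j x hx c _ (apply_transition hT hx.2 i c).symm, (hV j).mem_nhds hx.2]
    with y hy hyj
  exact (hT j y hyj).injective ((apply_transition hT hyj i c).trans hy)

/-- The bundle with discrete fibre `J` glued from local sections with unique continuation. -/
def localSystemCore [TopologicalSpace J] [DiscreteTopology J] (hV : ∀ i, IsOpen (V i))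
    (hmem : ∀ i, i ∈ V i) (hT : ∀ i, ∀ x ∈ V i, (T i x).Bijective)
    (hcont : ∀ i j, ∀ x ∈ V i ∩ V j, ∀ c d, T i x c = T j x d → ∀ᶠ y in 𝓝 x, T i y c = T j y d) :
    FiberBundleCore X X J where
  baseSet := V
  isOpen_baseSet := hV
  indexAt := id
  mem_baseSet_at := hmem
  coordChange := transition T
  coordChange_self i x hx c := (hT i x hx).injective (apply_transition hT hx i c)
  continuousOn_coordChange i j := by
    rintro ⟨x, c⟩ ⟨hx, -⟩
    refine ((continuousAt_const (y := transition T i j x c)).congr ?_).continuousWithinAt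
    rw [nhds_prod_eq, nhds_discrete J, EventuallyEq, prod_pure, eventually_map]
    exact (eventually_transition_eq hV hT hcont hx c).mono fun y hy ↦ hy.symm
  coordChange_comp i j k x hx c := (hT k x hx.2).injective <| by
    simp only [apply_transition hT hx.2, apply_transition hT hx.1.2]

theorem exists_section_of_localSystem [SimplyConnectedSpace X] [LocallyPathConnectedSpace X]
    (hV : ∀ i, IsOpen (V i)) (hmem : ∀ i, i ∈ V i) (hT : ∀ i, ∀ x ∈ V i, (T i x).Bijective)
    (hcont : ∀ i j, ∀ x ∈ V i ∩ V j, ∀ c d, T i x c = T j x d → ∀ᶠ y in 𝓝 x, T i y c = T j y d)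
    (P : X) (c : J) :
    ∃ s : (x : X) → Φ x, s P = T P P c ∧ ∀ i, ∃ d, ∀ᶠ x in 𝓝 i, s x = T i x d := by
  let _ : TopologicalSpace J := ⊥
  have : DiscreteTopology J := ⟨rfl⟩
  let Z := localSystemCore hV hmem hT hcont
  have hcov : IsCoveringMap (π J Z.Fiber) := FiberBundle.isCoveringMap (F := J)
  obtain ⟨F, ⟨hFP, hF⟩, -⟩ :=
    hcov.existsUnique_continuousMap_lifts (ContinuousMap.id X) P ⟨P, c⟩ rfl
  have hproj (x : X) : (F x).proj = x := congrFun hF x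
  have hval (e : TotalSpace J Z.Fiber) (i : X) (hi : e.proj ∈ V i) :
      T i e.proj (Z.localTriv i e).2 = T e.proj e.proj e.2 := apply_transition hT hi _ _
  refine ⟨fun x ↦ T x x (Z.localTriv x (F x)).2, ?_, fun i ↦ ⟨(Z.localTriv i (F i)).2, ?_⟩⟩
  · simpa only [hFP] using hval ⟨P, c⟩ P (hmem P)
  · have hloc : ContinuousAt (fun x ↦ (Z.localTriv i (F x)).2) i := by
      refine continuousAt_snd.comp (ContinuousAt.comp ?_ F.continuous.continuousAt)
      refine (Z.localTriv i).continuousAt ((Z.localTriv i).mem_source.2 ?_)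
      change (F i).proj ∈ V i
      exact (hproj i).symm ▸ hmem i
    rw [ContinuousAt, nhds_discrete J, tendsto_pure] at hloc
    filter_upwards [hloc, (hV i).mem_nhds (hmem i)] with x hx hxi
    have h := (hval (F x) x (by rw [hproj]; exact hmem x)).trans
      (hval (F x) i (by rwa [hproj])).symm
    rw [hproj] at h
    rw [h, hx]

end LocalSystems

section Coordinates

open Set Filter Topology

variable {m : ℕ} {M : Type*} [TopologicalSpace M] [ChartedSpace (EuclideanSpace ℝ (Fin m)) M]
  {G : Type*} [NormedAddCommGroup G] [NormedSpace ℝ G] {x₀ q : M}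

local notation "E" => EuclideanSpace ℝ (Fin m)
local notation "φ" => extChartAt (𝓡 m)

lemma extChartAt_source_mem_nhds_of_mem (hq : q ∈ (φ x₀).source) : (φ x₀).source ∈ 𝓝 q :=
  (isOpen_extChartAt_source x₀).mem_nhds hq

lemma eventuallyEq_comp_symm_comp {α : Type*} (hq : q ∈ (φ x₀).source) (f : M → α) :
    f =ᶠ[𝓝 q] (f ∘ (φ x₀).symm) ∘ φ x₀ := by
  filter_upwards [extChartAt_source_mem_nhds_of_mem hq] with z hz
  rw [Function.comp_apply, Function.comp_apply, (φ x₀).left_inv hz]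

lemma mvfderiv_congr {f f' : M → G} (h : f =ᶠ[𝓝 q] f') :
    mvfderiv (𝓡 m) f q = mvfderiv (𝓡 m) f' q := by
  ext w
  exact congrArg (· w) (h.mfderiv_eq (I := 𝓡 m) (I' := 𝓘(ℝ, G)))

variable [IsManifold (𝓡 m) ∞ M]

/-- The components, in the chart at `x₀`, of the tangent vectors at `q`; meaningful when `q` lies
in the source of that chart. -/
def chartMap (x₀ q : M) : TangentSpace (𝓡 m) q →L[ℝ] E :=
  (trivializationAt E (TangentSpace (𝓡 m)) x₀).continuousLinearMapAt ℝ q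

/-- The tangent vector at `q` with given components in the chart at `x₀`. -/
def chartInv (x₀ q : M) : E →L[ℝ] TangentSpace (𝓡 m) q :=
  (trivializationAt E (TangentSpace (𝓡 m)) x₀).symmL ℝ q

lemma mem_trivializationAt_baseSet (hq : q ∈ (φ x₀).source) :
    q ∈ (trivializationAt E (TangentSpace (𝓡 m)) x₀).baseSet := by
  rwa [TangentBundle.trivializationAt_baseSet, ← extChartAt_source (𝓡 m)]

lemma chartMap_chartInv (hq : q ∈ (φ x₀).source) (v : E) : chartMap x₀ q (chartInv x₀ q v) = v :=
  Trivialization.continuousLinearMapAt_symmL _ (mem_trivializationAt_baseSet hq) v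

lemma chartInv_chartMap (hq : q ∈ (φ x₀).source) (v : TangentSpace (𝓡 m) q) :
    chartInv x₀ q (chartMap x₀ q v) = v :=
  Trivialization.symmL_continuousLinearMapAt _ (mem_trivializationAt_baseSet hq) v

lemma chartMap_eq_mfderiv (hq : q ∈ (φ x₀).source) :
    chartMap x₀ q = mfderiv (𝓡 m) 𝓘(ℝ, E) (φ x₀) q :=
  TangentBundle.continuousLinearMapAt_trivializationAt (by rwa [← extChartAt_source (𝓡 m)])

lemma chartMap_apply (hq : q ∈ (φ x₀).source) (v : TangentSpace (𝓡 m) q) :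
    chartMap x₀ q v = (trivializationAt E (TangentSpace (𝓡 m)) x₀ ⟨q, v⟩).2 := by
  simp [chartMap, Trivialization.coe_linearMapAt_of_mem _ (mem_trivializationAt_baseSet hq)]

lemma vfDiffAt_iff_chartMap (hq : q ∈ (φ x₀).source) {Y : Π x : M, TangentSpace (𝓡 m) x} :
    VFDiffAt Y q ↔ MDifferentiableAt (𝓡 m) 𝓘(ℝ, E) (fun x ↦ chartMap x₀ x (Y x)) q := by
  refine (Trivialization.mdifferentiableAt_section_iff (𝓡 m)
    (trivializationAt E (TangentSpace (𝓡 m)) x₀) Y (mem_trivializationAt_baseSet hq)).trans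
    (EventuallyEq.mdifferentiableAt_iff ?_)
  filter_upwards [extChartAt_source_mem_nhds_of_mem hq] with z hz
  rw [chartMap_apply hz]

lemma contMDiffAt_section_iff_chartMap (hq : q ∈ (φ x₀).source) {n : ℕ∞ω} (hn : n ≤ ∞)
    {Y : Π x : M, TangentSpace (𝓡 m) x} :
    ContMDiffAt (𝓡 m) ((𝓡 m).prod 𝓘(ℝ, E)) n (fun y ↦ (⟨y, Y y⟩ : TangentBundle (𝓡 m) M)) q ↔
      ContMDiffAt (𝓡 m) 𝓘(ℝ, E) n (fun x ↦ chartMap x₀ x (Y x)) q := by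
  have : ContMDiffVectorBundle n E (TangentSpace (𝓡 m) : M → Type _) (𝓡 m) :=
    ContMDiffVectorBundle.of_le hn
  refine (Trivialization.contMDiffAt_section_iff (trivializationAt E (TangentSpace (𝓡 m)) x₀)
    (mem_trivializationAt_baseSet hq)).trans (EventuallyEq.contMDiffAt_iff ?_)
  filter_upwards [extChartAt_source_mem_nhds_of_mem hq] with z hz
  rw [chartMap_apply hz]

lemma contDiffAt_comp_symm (hq : q ∈ (φ x₀).source) {f : M → G} {n : ℕ∞ω} (hn : n ≤ ∞)
    (hf : ContMDiffAt (𝓡 m) 𝓘(ℝ, G) n f q) : ContDiffAt ℝ n (f ∘ (φ x₀).symm) (φ x₀ q) := by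
  rw [← contMDiffAt_iff_contDiffAt]
  have hsymm := ((contMDiffOn_extChartAt_symm (I := 𝓡 m) (n := ∞) x₀).of_le hn).contMDiffAt
    (extChartAt_target_mem_nhds' (I := 𝓡 m) ((φ x₀).map_source hq))
  exact ContMDiffAt.comp _ (by rwa [(φ x₀).left_inv hq]) hsymm

lemma mdifferentiableAt_iff_comp_symm (hq : q ∈ (φ x₀).source) {f : M → G} :
    MDifferentiableAt (𝓡 m) 𝓘(ℝ, G) f q ↔ DifferentiableAt ℝ (f ∘ (φ x₀).symm) (φ x₀ q) := by
  rw [← mdifferentiableAt_iff_differentiableAt]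
  constructor <;> intro hf
  · have hsymm := ((contMDiffOn_extChartAt_symm (I := 𝓡 m) (n := ∞) x₀).contMDiffAt
      (extChartAt_target_mem_nhds' (I := 𝓡 m) ((φ x₀).map_source hq))).mdifferentiableAt (by simp)
    exact MDifferentiableAt.comp _ (by rwa [(φ x₀).left_inv hq]) hsymm
  · exact (hf.comp q (mdifferentiableAt_extChartAt (by rwa [← extChartAt_source (𝓡 m)])))
      |>.congr_of_eventuallyEq (eventuallyEq_comp_symm_comp hq f)

lemma mvfderiv_comp_extChartAt (hq : q ∈ (φ x₀).source) {u : E → G}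
    (hu : DifferentiableAt ℝ u (φ x₀ q)) (w : TangentSpace (𝓡 m) q) :
    mvfderiv (𝓡 m) (u ∘ φ x₀) q w = fderiv ℝ u (φ x₀ q) (chartMap x₀ q w) := by
  have h := mfderiv_comp_apply q hu.mdifferentiableAt
    (mdifferentiableAt_extChartAt (I := 𝓡 m) (by rwa [← extChartAt_source (𝓡 m)])) w
  rw [mfderiv_eq_fderiv] at h
  rw [chartMap_eq_mfderiv hq]
  exact h

lemma mvfderiv_eq_fderiv_comp_symm (hq : q ∈ (φ x₀).source) {f : M → G}
    (hf : MDifferentiableAt (𝓡 m) 𝓘(ℝ, G) f q) (w : TangentSpace (𝓡 m) q) :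
    mvfderiv (𝓡 m) f q w = fderiv ℝ (f ∘ (φ x₀).symm) (φ x₀ q) (chartMap x₀ q w) := by
  rw [← mvfderiv_comp_extChartAt hq ((mdifferentiableAt_iff_comp_symm hq).1 hf),
    mvfderiv_congr (eventuallyEq_comp_symm_comp hq f)]

end Coordinates

section Christoffel

open Set Filter Topology

variable {m : ℕ} {M : Type*} [TopologicalSpace M] [ChartedSpace (EuclideanSpace ℝ (Fin m)) M]
  [IsManifold (𝓡 m) ∞ M] {x₀ q : M}

local notation "E" => EuclideanSpace ℝ (Fin m)
local notation "φ" => extChartAt (𝓡 m)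

/-- The flat covariant derivative on the source of the chart at `x₀`, which differentiates the
components of vector fields. -/
def chartConn (x₀ : M) (Y : Π x : M, TangentSpace (𝓡 m) x) (q : M) :
    TangentSpace (𝓡 m) q →L[ℝ] TangentSpace (𝓡 m) q :=
  chartInv x₀ q ∘L mvfderiv (𝓡 m) (fun x ↦ chartMap x₀ x (Y x)) q

lemma isCovariantDerivativeOn_chartConn (x₀ : M) :
    IsCovariantDerivativeOn E (chartConn (m := m) x₀) (φ x₀).source where
  add {Y Y' x} hY hY' hx := by
    have h := mvfderiv_add ((vfDiffAt_iff_chartMap hx).1 hY) ((vfDiffAt_iff_chartMap hx).1 hY')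
    rw [chartConn, chartConn, chartConn, ← ContinuousLinearMap.comp_add, ← h]
    congr 2
    ext1 z
    simp
  leibniz {Y g x} hY hg hx := by
    have h := mvfderiv_smul hg ((vfDiffAt_iff_chartMap hx).1 hY)
    have hsmul : (fun z ↦ chartMap x₀ z ((g • Y) z)) = g • fun z ↦ chartMap x₀ z (Y z) := by
      ext1 z
      simp
    ext1 v
    rw [chartConn, hsmul, h]
    simp [chartConn, chartInv_chartMap hx]

/-- The Christoffel symbols of `A` in the chart at `x₀`: `christoffel A x₀ q w v` are the components
of `∇_v W` at `q`, where `W` has constant components `w`. -/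
def christoffel (A : AffineStructure m M) (x₀ q : M) : E →L[ℝ] E →L[ℝ] E :=
  (chartMap x₀ q).postcomp E ∘L (chartInv x₀ q).precomp (TangentSpace (𝓡 m) q) ∘L
    (A.conn.isCovariantDerivativeOn (s := (φ x₀).source)).difference
      (isCovariantDerivativeOn_chartConn x₀) q ∘L chartInv x₀ q

lemma chartMap_conn (A : AffineStructure m M) (hq : q ∈ (φ x₀).source)
    {Y : Π x : M, TangentSpace (𝓡 m) x} (hY : VFDiffAt Y q) (w : TangentSpace (𝓡 m) q) :
    chartMap x₀ q (A.conn Y q w) = mvfderiv (𝓡 m) (fun x ↦ chartMap x₀ x (Y x)) q w +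
      christoffel A x₀ q (chartMap x₀ q (Y q)) (chartMap x₀ q w) := by
  have h := congrArg (fun L : TangentSpace (𝓡 m) q →L[ℝ] TangentSpace (𝓡 m) q ↦
    chartMap x₀ q (L w)) <| IsCovariantDerivativeOn.difference_apply
      (A.conn.isCovariantDerivativeOn (s := (φ x₀).source))
      (isCovariantDerivativeOn_chartConn x₀) hq hY
  have hY' : christoffel A x₀ q (chartMap x₀ q (Y q)) (chartMap x₀ q w) =
      chartMap x₀ q (A.conn Y q w) - mvfderiv (𝓡 m) (fun x ↦ chartMap x₀ x (Y x)) q w := by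
    simp only [christoffel, ContinuousLinearMap.comp_apply, ContinuousLinearMap.precomp_apply,
      ContinuousLinearMap.postcomp_apply, chartInv_chartMap hq]
    refine h.trans ?_
    simp [chartConn, chartMap_chartInv hq]
  rw [hY', add_sub_cancel]

/-- The vector field on the source of the chart at `x₀` with constant components `v`. -/
def coordField (x₀ : M) (v : E) : Π q : M, TangentSpace (𝓡 m) q := fun q ↦ chartInv x₀ q v

lemma chartMap_coordField (hq : q ∈ (φ x₀).source) (v : E) :
    chartMap x₀ q (coordField x₀ v q) = v :=
  chartMap_chartInv hq v

lemma eventuallyEq_chartMap_coordField (hq : q ∈ (φ x₀).source) (v : E) :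
    (fun x ↦ chartMap x₀ x (coordField x₀ v x)) =ᶠ[𝓝 q] fun _ ↦ v := by
  filter_upwards [extChartAt_source_mem_nhds_of_mem hq] with x hx using chartMap_coordField hx v

lemma contMDiffOn_coordField (x₀ : M) (v : E) :
    ContMDiffOn (𝓡 m) ((𝓡 m).prod 𝓘(ℝ, E)) ∞
      (fun y ↦ (⟨y, coordField x₀ v y⟩ : TangentBundle (𝓡 m) M)) (φ x₀).source := fun _ hq ↦
  ((contMDiffAt_section_iff_chartMap hq le_rfl).2 (contMDiffAt_const.congr_of_eventuallyEq
    (eventuallyEq_chartMap_coordField hq v))).contMDiffWithinAt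

lemma vfDiffAt_coordField (hq : q ∈ (φ x₀).source) (v : E) : VFDiffAt (coordField x₀ v) q :=
  ((contMDiffOn_coordField x₀ v).contMDiffAt
    (extChartAt_source_mem_nhds_of_mem hq)).mdifferentiableAt (by simp)

lemma chartMap_conn_coordField (A : AffineStructure m M) (hq : q ∈ (φ x₀).source) (w : E)
    (v : TangentSpace (𝓡 m) q) :
    chartMap x₀ q (A.conn (coordField x₀ w) q v) = christoffel A x₀ q w (chartMap x₀ q v) := by
  rw [chartMap_conn A hq (vfDiffAt_coordField hq w),
    mvfderiv_congr (eventuallyEq_chartMap_coordField hq w), mvfderiv_const, chartMap_coordField hq,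
    zero_apply, zero_add]

lemma coordField_eventuallyEq_mpullback (hq : q ∈ (φ x₀).source) (v : E) :
    (coordField x₀ v : Π x : M, TangentSpace (𝓡 m) x) =ᶠ[𝓝 q]
      mpullback (𝓡 m) 𝓘(ℝ, E) (φ x₀)
        (fun _ ↦ v : Π p : E, TangentSpace 𝓘(ℝ, E) p) := by
  filter_upwards [extChartAt_source_mem_nhds_of_mem hq] with x hx
  refine Eq.trans ?_ (mpullback_apply ..).symm
  rw [← chartMap_eq_mfderiv hx]
  exact congrArg (fun L : E →L[ℝ] TangentSpace (𝓡 m) x ↦ L v)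
    (ContinuousLinearMap.inverse_eq (f := chartMap x₀ x) (g := chartInv x₀ x)
      (ContinuousLinearMap.ext (chartMap_chartInv hx))
      (ContinuousLinearMap.ext (chartInv_chartMap hx))).symm

lemma mlieBracket_coordField (hq : q ∈ (φ x₀).source) (v w : E) :
    mlieBracket (𝓡 m) (coordField x₀ v) (coordField x₀ w) q = 0 := by
  have hsmooth : minSmoothness ℝ 2 ≤ ∞ := by
    rw [minSmoothness_of_isRCLikeNormedField]; exact ENat.LEInfty.out
  have : IsManifold (𝓡 m) (minSmoothness ℝ 2) M := IsManifold.of_le hsmooth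
  let const (v p : E) : TangentSpace 𝓘(ℝ, E) p := v
  have hconst (v : E) : MDifferentiableAt 𝓘(ℝ, E) (𝓘(ℝ, E).prod 𝓘(ℝ, E))
      (fun y ↦ (⟨y, const v y⟩ : TangentBundle 𝓘(ℝ, E) E)) (φ x₀ q) :=
    ((contMDiff_vectorSpace_iff_contDiff (n := 1) (V := const v)).2 contDiff_const _)
      |>.mdifferentiableAt one_ne_zero
  have hbracket : lieBracket ℝ (const v) (const w) (φ x₀ q) = 0 := by
    simp [lieBracket, const]
  rw [(coordField_eventuallyEq_mpullback hq v).mlieBracket_vectorField_eq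
      (coordField_eventuallyEq_mpullback hq w),
    ← mpullback_mlieBracket (n := ∞) (hconst v) (hconst w)
      (contMDiffAt_extChartAt' (by rwa [← extChartAt_source (𝓡 m)])) hsmooth,
    mpullback_apply, ← mlieBracketWithin_univ, mlieBracketWithin_eq_lieBracketWithin,
    lieBracketWithin_univ, hbracket]
  exact map_zero (mfderiv (𝓡 m) 𝓘(ℝ, E) (φ x₀) q).inverse

lemma christoffel_symm (A : AffineStructure m M) (hq : q ∈ (φ x₀).source) (w v : E) :
    christoffel A x₀ q w v = christoffel A x₀ q v w := by
  have h := (CovariantDerivative.torsion_eq_zero_iff A.conn).1 A.torsion_free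
    (vfDiffAt_coordField hq v) (vfDiffAt_coordField hq w)
  rw [mlieBracket_coordField hq, sub_eq_zero] at h
  rw [← chartMap_coordField hq v, ← chartMap_conn_coordField A hq, h,
    chartMap_conn_coordField A hq, chartMap_coordField hq, chartMap_coordField hq]

end Christoffel

section SmoothCoordinates

open Set Filter Topology

variable {m : ℕ} {M : Type*} [TopologicalSpace M] [ChartedSpace (EuclideanSpace ℝ (Fin m)) M]
  [IsManifold (𝓡 m) ∞ M] {x₀ q : M}

local notation "E" => EuclideanSpace ℝ (Fin m)
local notation "φ" => extChartAt (𝓡 m)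

lemma vfDiffAt_smoothVF (X : SmoothVF m M) (x : M) : VFDiffAt X x :=
  (X.contMDiff x).mdifferentiableAt (by simp)

lemma AffineStructure.contMDiff_conn (A : AffineStructure m M) (X Y : SmoothVF m M) :
    ContMDiff (𝓡 m) ((𝓡 m).prod 𝓘(ℝ, E)) ∞
      (fun y ↦ (⟨y, A.conn Y y (X y)⟩ : TangentBundle (𝓡 m) M)) := by
  intro x
  have hY := A.smooth.contMDiff.contMDiff (σ := fun x ↦ Y x) (by
    simpa using! Y.contMDiff.contMDiffOn)
  exact ContMDiffAt.clm_bundle_apply (hY.contMDiffAt univ_mem) (X.contMDiff x)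

/-- The Christoffel symbols in the chart at `x₀`, as functions on the target of that chart. -/
def christoffelChart (A : AffineStructure m M) (x₀ : M) (p : E) : E →L[ℝ] E →L[ℝ] E :=
  christoffel A x₀ ((φ x₀).symm p)

lemma eventuallyEq_chartMap_conn (A : AffineStructure m M) (hq : q ∈ (φ x₀).source)
    {W Z : SmoothVF m M} {w z : E}
    (hW : (W : Π x : M, TangentSpace (𝓡 m) x) =ᶠ[𝓝 q] coordField x₀ w)
    (hZ : (Z : Π x : M, TangentSpace (𝓡 m) x) =ᶠ[𝓝 q] coordField x₀ z) :
    (fun x ↦ chartMap x₀ x (A.conn Z x (W x))) =ᶠ[𝓝 q] fun x ↦ christoffel A x₀ x z w := by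
  filter_upwards [extChartAt_source_mem_nhds_of_mem hq, hW, hZ.eventually_nhds] with x hx hWx hZx
  rw [A.conn.isCovariantDerivativeOnUniv.congr_of_eventuallyEq (vfDiffAt_smoothVF Z x)
    (vfDiffAt_coordField hx z) univ_mem hZx, hWx, chartMap_conn_coordField A hx,
    chartMap_coordField hx]

lemma eventuallyEq_fderiv_comp_symm (hq : q ∈ (φ x₀).source) {f : M → ℝ}
    (hf : ContMDiffAt (𝓡 m) 𝓘(ℝ, ℝ) ∞ f q) (Y : Π x : M, TangentSpace (𝓡 m) x) :
    (fun x ↦ mvfderiv (𝓡 m) f x (Y x)) =ᶠ[𝓝 q]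
      (fun p ↦ fderiv ℝ (f ∘ (φ x₀).symm) p
        (((fun x ↦ chartMap x₀ x (Y x)) ∘ (φ x₀).symm) p)) ∘ φ x₀ := by
  have hfev := (contMDiffAt_iff_contMDiffAt_nhds (by simp)).1
    (hf.of_le (m := 1) ENat.LEInfty.out)
  filter_upwards [extChartAt_source_mem_nhds_of_mem hq, hfev] with x hx hfx
  rw [mvfderiv_eq_fderiv_comp_symm hx (hfx.mdifferentiableAt one_ne_zero), Function.comp_apply,
    Function.comp_apply, (φ x₀).left_inv hx]

lemma differentiableAt_fderiv_comp_symm (hq : q ∈ (φ x₀).source) {f : M → ℝ}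
    (hf : ContMDiffAt (𝓡 m) 𝓘(ℝ, ℝ) ∞ f q) :
    DifferentiableAt ℝ (fderiv ℝ (f ∘ (φ x₀).symm)) (φ x₀ q) :=
  ((contDiffAt_comp_symm hq le_rfl hf).fderiv_right (m := 1)
    (by rw [one_add_one_eq_two]; exact ENat.LEInfty.out)).differentiableAt one_ne_zero

lemma mdifferentiableAt_mvfderiv_apply {f : M → ℝ} (hf : ContMDiffAt (𝓡 m) 𝓘(ℝ, ℝ) ∞ f q)
    {Y : Π x : M, TangentSpace (𝓡 m) x} (hY : VFDiffAt Y q) :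
    MDifferentiableAt (𝓡 m) 𝓘(ℝ, ℝ) (fun x ↦ mvfderiv (𝓡 m) f x (Y x)) q := by
  have hq := mem_extChartAt_source (I := 𝓡 m) q
  have hYq := (mdifferentiableAt_iff_comp_symm hq).1 ((vfDiffAt_iff_chartMap hq).1 hY)
  refine MDifferentiableAt.congr_of_eventuallyEq ?_ (eventuallyEq_fderiv_comp_symm hq hf Y)
  exact ((differentiableAt_fderiv_comp_symm hq hf).clm_apply hYq).comp_mdifferentiableAt
    (mdifferentiableAt_extChartAt (mem_chart_source _ q))

lemma hessian_eq_christoffel (A : AffineStructure m M) (hq : q ∈ (φ x₀).source) {f : M → ℝ}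
    (hf : ContMDiffAt (𝓡 m) 𝓘(ℝ, ℝ) ∞ f q) (X Y : SmoothVF m M) :
    A.hessian f X Y q =
      fderiv ℝ (fderiv ℝ (f ∘ (φ x₀).symm)) (φ x₀ q) (chartMap x₀ q (X q)) (chartMap x₀ q (Y q)) -
        fderiv ℝ (f ∘ (φ x₀).symm) (φ x₀ q)
          (christoffel A x₀ q (chartMap x₀ q (Y q)) (chartMap x₀ q (X q))) := by
  have hY := (vfDiffAt_iff_chartMap hq).1 (vfDiffAt_smoothVF Y q)
  have hd := (differentiableAt_fderiv_comp_symm hq hf).hasFDerivAt.clm_apply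
    ((mdifferentiableAt_iff_comp_symm hq).1 hY).hasFDerivAt
  have hYq : ((fun x ↦ chartMap x₀ x (Y x)) ∘ (φ x₀).symm) (φ x₀ q) = chartMap x₀ q (Y q) := by
    rw [Function.comp_apply, (φ x₀).left_inv hq]
  rw [AffineStructure.hessian, mvfderiv_congr (eventuallyEq_fderiv_comp_symm hq hf Y),
    mvfderiv_comp_extChartAt hq hd.differentiableAt, hd.fderiv,
    mvfderiv_eq_fderiv_comp_symm hq (hf.mdifferentiableAt (by simp)),
    chartMap_conn A hq (vfDiffAt_smoothVF Y q), mvfderiv_eq_fderiv_comp_symm hq hY, map_add]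
  simp only [add_apply, ContinuousLinearMap.comp_apply, ContinuousLinearMap.flip_apply, hYq]
  ring

lemma AffineStructure.hessian_symm (A : AffineStructure m M) {f : M → ℝ}
    (hf : ContMDiffAt (𝓡 m) 𝓘(ℝ, ℝ) ∞ f q) (X Y : SmoothVF m M) :
    A.hessian f X Y q = A.hessian f Y X q := by
  have hq := mem_extChartAt_source (I := 𝓡 m) q
  have hsymm : IsSymmSndFDerivAt ℝ (f ∘ (φ q).symm) (φ q q) :=
    (contDiffAt_comp_symm hq le_rfl hf).isSymmSndFDerivAt
      (by rw [minSmoothness_of_isRCLikeNormedField]; exact ENat.LEInfty.out)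
  rw [hessian_eq_christoffel A hq hf, hessian_eq_christoffel A hq hf, hsymm, christoffel_symm A hq]

variable [T2Space M]

lemma exists_smoothVF_eventuallyEq {u : Set M} (hu : IsOpen u) (hq : q ∈ u)
    {Y : Π x : M, TangentSpace (𝓡 m) x} (hY : ContMDiffOn (𝓡 m) ((𝓡 m).prod 𝓘(ℝ, E)) ∞
      (fun y ↦ (⟨y, Y y⟩ : TangentBundle (𝓡 m) M)) u) :
    ∃ X : SmoothVF m M, (X : Π x : M, TangentSpace (𝓡 m) x) =ᶠ[𝓝 q] Y := by
  obtain ⟨ψ, hψ, -⟩ :=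
    (SmoothBumpFunction.nhds_basis_support (I := 𝓡 m) (hu.mem_nhds hq)).mem_iff.1 univ_mem
  refine ⟨⟨_, ContMDiffOn.smul_section_of_tsupport ψ.contMDiff.contMDiffOn hu hψ hY⟩, ?_⟩
  filter_upwards [ψ.eventuallyEq_one] with x hx
  change ψ x • Y x = Y x
  rw [hx, Pi.one_apply, one_smul]

lemma exists_smoothVF_eventuallyEq_coordField (hq : q ∈ (φ x₀).source) (v : E) :
    ∃ X : SmoothVF m M, (X : Π x : M, TangentSpace (𝓡 m) x) =ᶠ[𝓝 q] coordField x₀ v :=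
  exists_smoothVF_eventuallyEq (isOpen_extChartAt_source x₀) hq (contMDiffOn_coordField x₀ v)

lemma exists_smoothVF_apply_eq (x : M) (v : TangentSpace (𝓡 m) x) :
    ∃ X : SmoothVF m M, X x = v := by
  have hx := mem_extChartAt_source (I := 𝓡 m) x
  obtain ⟨X, hX⟩ := exists_smoothVF_eventuallyEq_coordField hx (chartMap x x v)
  exact ⟨X, hX.self_of_nhds.trans (chartInv_chartMap hx v)⟩

lemma contDiffOn_christoffelChart (A : AffineStructure m M) (x₀ : M) :
    ContDiffOn ℝ ∞ (christoffelChart A x₀) (φ x₀).target := by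
  refine contDiffOn_clm_apply.2 fun w ↦ contDiffOn_clm_apply.2 fun v p hp ↦ ?_
  have hq : (φ x₀).symm p ∈ (φ x₀).source := (φ x₀).map_target hp
  obtain ⟨V, hV⟩ := exists_smoothVF_eventuallyEq_coordField hq v
  obtain ⟨W, hW⟩ := exists_smoothVF_eventuallyEq_coordField hq w
  have h := contDiffAt_comp_symm hq le_rfl <|
    ((contMDiffAt_section_iff_chartMap hq le_rfl).1 (A.contMDiff_conn V W _)).congr_of_eventuallyEq
      (eventuallyEq_chartMap_conn A hq hV hW).symm
  rw [(φ x₀).right_inv hp] at h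
  exact h.contDiffWithinAt

lemma differentiableAt_christoffelChart (A : AffineStructure m M) {p : E}
    (hp : p ∈ (φ x₀).target) : DifferentiableAt ℝ (christoffelChart A x₀) p :=
  ((contDiffOn_christoffelChart A x₀).contDiffAt
    ((isOpen_extChartAt_target x₀).mem_nhds hp)).differentiableAt (by simp)

lemma chartMap_conn_conn (A : AffineStructure m M) (hq : q ∈ (φ x₀).source) {W Z : SmoothVF m M}
    {w z : E} (hW : (W : Π x : M, TangentSpace (𝓡 m) x) =ᶠ[𝓝 q] coordField x₀ w)
    (hZ : (Z : Π x : M, TangentSpace (𝓡 m) x) =ᶠ[𝓝 q] coordField x₀ z)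
    (v : TangentSpace (𝓡 m) q) :
    chartMap x₀ q (A.conn (fun x ↦ A.conn Z x (W x)) q v) =
      fderiv ℝ (christoffelChart A x₀) (φ x₀ q) (chartMap x₀ q v) z w +
        christoffel A x₀ q (christoffel A x₀ q z w) (chartMap x₀ q v) := by
  have hWZ := eventuallyEq_chartMap_conn A hq hW hZ
  have hΓ := ((differentiableAt_christoffelChart A ((φ x₀).map_source hq)).hasFDerivAt.clm_apply
    (hasFDerivAt_const z _)).clm_apply (hasFDerivAt_const w _)
  rw [chartMap_conn A hq (A.mdifferentiableAt_conn Z (vfDiffAt_smoothVF W q)),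
    show chartMap x₀ q (A.conn Z q (W q)) = _ from hWZ.self_of_nhds,
    mvfderiv_congr (hWZ.trans (eventuallyEq_comp_symm_comp hq _))]
  congr 1
  refine (mvfderiv_comp_extChartAt hq hΓ.differentiableAt v).trans ?_
  rw [hΓ.fderiv]
  simp

lemma curvature_christoffelChart {A : AffineStructure m M} (hA : IsFlat A.conn) {p : E}
    (hp : p ∈ (φ x₀).target) (v w z : E) :
    fderiv ℝ (christoffelChart A x₀) p v z w +
        christoffelChart A x₀ p (christoffelChart A x₀ p z w) v =
      fderiv ℝ (christoffelChart A x₀) p w z v +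
        christoffelChart A x₀ p (christoffelChart A x₀ p z v) w := by
  have hq : (φ x₀).symm p ∈ (φ x₀).source := (φ x₀).map_target hp
  obtain ⟨V, hV⟩ := exists_smoothVF_eventuallyEq_coordField hq v
  obtain ⟨W, hW⟩ := exists_smoothVF_eventuallyEq_coordField hq w
  obtain ⟨Z, hZ⟩ := exists_smoothVF_eventuallyEq_coordField hq z
  have hcurv := hA V W Z ((φ x₀).symm p)
  rw [curvature, hV.mlieBracket_vectorField_eq hW, mlieBracket_coordField hq, map_zero, sub_zero,
    sub_eq_zero] at hcurv
  have h := congrArg (chartMap x₀ _) hcurv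
  rw [chartMap_conn_conn A hq hW hZ, chartMap_conn_conn A hq hV hZ, hV.self_of_nhds,
    hW.self_of_nhds, chartMap_coordField hq, chartMap_coordField hq, (φ x₀).right_inv hp] at h
  exact h

end SmoothCoordinates

section AffineJets

set_option maxSynthPendingDepth 3

open Set Filter Topology
open ContinuousLinearMap (inl inr fst snd compL)

variable {E : Type*} [NormedAddCommGroup E] [NormedSpace ℝ E]

lemma hasFDerivAt_clm_apply_apply {F G H : Type*} [NormedAddCommGroup F] [NormedSpace ℝ F]
    [NormedAddCommGroup G] [NormedSpace ℝ G] [NormedAddCommGroup H] [NormedSpace ℝ H]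
    {B : E → F →L[ℝ] G →L[ℝ] H} {p : E} (hB : DifferentiableAt ℝ B p) (c : F) (w : G) :
    HasFDerivAt (fun p ↦ B p c w) (((fderiv ℝ B p).flip c).flip w) p := by
  simpa using (hB.hasFDerivAt.clm_apply (hasFDerivAt_const c p)).clm_apply (hasFDerivAt_const w p)

/-- First order jets of functions on `E`: a value and a differential. -/
abbrev Jet (E : Type*) [NormedAddCommGroup E] [NormedSpace ℝ E] : Type _ := ℝ × (E →L[ℝ] ℝ)

/-- The coefficients of the total differential system `dF = α`, `dα = α ∘ Γ` for the jet `(F, α)`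
of a function `F` that is affine for the connection with Christoffel symbols `Γ`. -/
def affineCoeff (Γ : E →L[ℝ] E →L[ℝ] E) : Jet E →L[ℝ] E →L[ℝ] Jet E :=
  ((inl ℝ ℝ (E →L[ℝ] ℝ)).postcomp E +
    (inr ℝ ℝ (E →L[ℝ] ℝ)).postcomp E ∘L Γ.flip.precomp (E →L[ℝ] ℝ) ∘L compL ℝ E E ℝ) ∘L
      snd ℝ ℝ (E →L[ℝ] ℝ)

lemma affineCoeff_apply (Γ : E →L[ℝ] E →L[ℝ] E) (c : Jet E) (v : E) :
    affineCoeff Γ c v = (c.2 v, c.2 ∘L Γ.flip v) := by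
  simp [affineCoeff]

lemma contDiff_affineCoeff {n : ℕ∞ω} : ContDiff ℝ n (affineCoeff (E := E)) := by
  have hprecomp : ContDiff ℝ n fun Γ : E →L[ℝ] E →L[ℝ] E ↦ Γ.flip.precomp (E →L[ℝ] ℝ) :=
    ((compL ℝ E (E →L[ℝ] E) (E →L[ℝ] ℝ)).flip).contDiff.comp
      (ContinuousLinearMap.flipₗᵢ ℝ E E E).contDiff
  exact (contDiff_const.add (contDiff_const.clm_comp (hprecomp.clm_comp contDiff_const))).clm_comp
    contDiff_const

lemma fderiv_affineCoeff {Γ : E → E →L[ℝ] E →L[ℝ] E} {p : E} (hΓ : DifferentiableAt ℝ Γ p)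
    (c : Jet E) (v w : E) :
    fderiv ℝ (fun p ↦ affineCoeff (Γ p)) p v c w = (0, c.2 ∘L (fderiv ℝ Γ p v).flip w) := by
  have hcoeff : DifferentiableAt ℝ (fun p ↦ affineCoeff (Γ p)) p :=
    ((contDiff_affineCoeff (E := E) (n := 1)).differentiable one_ne_zero _).comp p hΓ
  have h := hasFDerivAt_clm_apply_apply hcoeff c w
  simp only [affineCoeff_apply] at h
  refine Prod.ext ?_ (ContinuousLinearMap.ext fun z ↦ ?_)
  · exact DFunLike.congr_fun (h.fst.unique (hasFDerivAt_const (c.2 w) p)) v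
  · have hz : HasFDerivAt (fun p ↦ c.2 (Γ p z w)) _ p :=
      c.2.hasFDerivAt.comp p (hasFDerivAt_clm_apply_apply hΓ z w)
    exact DFunLike.congr_fun
      (((ContinuousLinearMap.apply ℝ ℝ z).hasFDerivAt.comp p h.snd).unique hz) v

lemma isIntegrableAt_affineCoeff {Γ : E → E →L[ℝ] E →L[ℝ] E} {p : E}
    (hΓ : DifferentiableAt ℝ Γ p) (hsymm : ∀ v w, Γ p v w = Γ p w v)
    (hcurv : ∀ v w z, fderiv ℝ Γ p v z w + Γ p (Γ p z w) v =
      fderiv ℝ Γ p w z v + Γ p (Γ p z v) w) :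
    IsIntegrableAt (fun p ↦ affineCoeff (Γ p)) p := by
  intro v w c
  rw [fderiv_affineCoeff hΓ, fderiv_affineCoeff hΓ]
  refine Prod.ext ?_ (ContinuousLinearMap.ext fun z ↦ ?_)
  · simp [affineCoeff_apply, hsymm v w]
  · simpa [affineCoeff_apply] using congrArg c.2 (hcurv v w z)

lemma isTotalSolutionOn_affineCoeff {Γ : E → E →L[ℝ] E →L[ℝ] E} {F : E → ℝ} {s : Set E}
    (hF : ∀ p ∈ s, DifferentiableAt ℝ F p) (hF' : ∀ p ∈ s, DifferentiableAt ℝ (fderiv ℝ F) p)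
    (hess : ∀ p ∈ s, ∀ v w, fderiv ℝ (fderiv ℝ F) p v w = fderiv ℝ F p (Γ p w v)) :
    IsTotalSolutionOn (fun p ↦ affineCoeff (Γ p)) (fun p ↦ (F p, fderiv ℝ F p)) s := fun p hp ↦
  ((hF p hp).hasFDerivAt.prodMk (hF' p hp).hasFDerivAt).congr_fderiv <|
    ContinuousLinearMap.ext fun v ↦ by
      rw [affineCoeff_apply]
      exact Prod.ext rfl (ContinuousLinearMap.ext fun w ↦ hess p hp v w)

lemma IsTotalSolutionOn.hasFDerivAt_fst {Γ : E → E →L[ℝ] E →L[ℝ] E} {u : E → Jet E} {s : Set E}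
    (hu : IsTotalSolutionOn (fun p ↦ affineCoeff (Γ p)) u s) {p : E} (hp : p ∈ s) :
    HasFDerivAt (fun p ↦ (u p).1) (u p).2 p :=
  (hu p hp).fst.congr_fderiv <| ContinuousLinearMap.ext fun v ↦ by simp [affineCoeff_apply]

lemma IsTotalSolutionOn.fderiv_fderiv_fst {Γ : E → E →L[ℝ] E →L[ℝ] E} {u : E → Jet E} {s : Set E}
    (hu : IsTotalSolutionOn (fun p ↦ affineCoeff (Γ p)) u s) (hs : IsOpen s) {p : E} (hp : p ∈ s)
    (v w : E) : fderiv ℝ (fderiv ℝ fun p ↦ (u p).1) p v w = (u p).2 (Γ p w v) := by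
  have hloc : fderiv ℝ (fun p ↦ (u p).1) =ᶠ[𝓝 p] fun p ↦ (u p).2 := by
    filter_upwards [hs.mem_nhds hp] with p hp using (hu.hasFDerivAt_fst hp).fderiv
  rw [hloc.fderiv_eq, (hu p hp).snd.fderiv]
  simp [affineCoeff_apply]

end AffineJets

section AffineFunctions

open Set Filter Topology Metric

set_option maxSynthPendingDepth 3

variable {m : ℕ} {M : Type*} [TopologicalSpace M] [ChartedSpace (EuclideanSpace ℝ (Fin m)) M]
  {x₀ q : M} {f f' : M → ℝ}

local notation "E" => EuclideanSpace ℝ (Fin m)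
local notation "φ" => extChartAt (𝓡 m)

/-- The first order jet of a function at a point. -/
def jetAt (f : M → ℝ) (x : M) : ℝ × (TangentSpace (𝓡 m) x →L[ℝ] ℝ) := (f x, mvfderiv (𝓡 m) f x)

lemma jetAt_congr (h : f =ᶠ[𝓝 q] f') : jetAt (m := m) f q = jetAt f' q :=
  Prod.ext h.eq_of_nhds (mvfderiv_congr h)

variable [IsManifold (𝓡 m) ∞ M] {A : AffineStructure m M}

/-- `f` is smooth at `x` and its Hessian vanishes at `x`. -/
def IsAffineAt (A : AffineStructure m M) (f : M → ℝ) (x : M) : Prop :=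
  ContMDiffAt (𝓡 m) 𝓘(ℝ, ℝ) ∞ f x ∧ ∀ X Y : SmoothVF m M, A.hessian f X Y x = 0

lemma IsAffineAt.congr (h : IsAffineAt A f q) (hff' : f' =ᶠ[𝓝 q] f) : IsAffineAt A f' q := by
  refine ⟨h.1.congr_of_eventuallyEq hff', fun X Y ↦ ?_⟩
  rw [← h.2 X Y, AffineStructure.hessian, AffineStructure.hessian, mvfderiv_congr hff',
    mvfderiv_congr (hff'.eventuallyEq_nhds.mono fun x hx ↦ congrArg (· (Y x)) (mvfderiv_congr hx))]

lemma jetAt_eq_comp_chartMap (hq : q ∈ (φ x₀).source) (hf : MDifferentiableAt (𝓡 m) 𝓘(ℝ, ℝ) f q) :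
    jetAt f q = (f q, fderiv ℝ (f ∘ (φ x₀).symm) (φ x₀ q) ∘L chartMap x₀ q) :=
  Prod.ext rfl (ContinuousLinearMap.ext (mvfderiv_eq_fderiv_comp_symm hq hf))

lemma bijective_comp_chartMap (hq : q ∈ (φ x₀).source) :
    Function.Bijective fun c : Jet E ↦ (c.1, c.2 ∘L chartMap x₀ q) := by
  refine Function.bijective_iff_has_inverse.2 ⟨fun d ↦ (d.1, d.2 ∘L chartInv x₀ q), fun c ↦ ?_,
    fun d ↦ ?_⟩
  · exact Prod.ext rfl (ContinuousLinearMap.ext fun v ↦ congrArg c.2 (chartMap_chartInv hq v))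
  · exact Prod.ext rfl (ContinuousLinearMap.ext fun v ↦ congrArg d.2 (chartInv_chartMap hq v))

variable [T2Space M]

lemma isAffineAt_iff_christoffel (hq : q ∈ (φ x₀).source) :
    IsAffineAt A f q ↔ ContMDiffAt (𝓡 m) 𝓘(ℝ, ℝ) ∞ f q ∧ ∀ v w : E,
      fderiv ℝ (fderiv ℝ (f ∘ (φ x₀).symm)) (φ x₀ q) v w =
        fderiv ℝ (f ∘ (φ x₀).symm) (φ x₀ q) (christoffel A x₀ q w v) := by
  refine and_congr_right fun hf ↦ ⟨fun h v w ↦ ?_, fun h X Y ↦ ?_⟩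
  · obtain ⟨X, hX⟩ := exists_smoothVF_apply_eq q (chartInv x₀ q v)
    obtain ⟨Y, hY⟩ := exists_smoothVF_apply_eq q (chartInv x₀ q w)
    simpa [hessian_eq_christoffel A hq hf, hX, hY, chartMap_chartInv hq, sub_eq_zero] using h X Y
  · rw [hessian_eq_christoffel A hq hf, h, sub_self]

lemma isTotalSolutionOn_of_isAffineAt {s : Set E} (hs : s ⊆ (φ x₀).target)
    (hf : ∀ p ∈ s, IsAffineAt A f ((φ x₀).symm p)) :
    IsTotalSolutionOn (fun p ↦ affineCoeff (christoffelChart A x₀ p))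
      (fun p ↦ ((f ∘ (φ x₀).symm) p, fderiv ℝ (f ∘ (φ x₀).symm) p)) s := by
  refine isTotalSolutionOn_affineCoeff (fun p hp ↦ ?_) (fun p hp ↦ ?_) fun p hp v w ↦ ?_
  all_goals have hq := (φ x₀).map_target (hs hp)
  · simpa only [(φ x₀).right_inv (hs hp)] using
      (contDiffAt_comp_symm hq le_rfl (hf p hp).1).differentiableAt (by simp)
  · simpa only [(φ x₀).right_inv (hs hp)] using differentiableAt_fderiv_comp_symm hq (hf p hp).1
  · rw [christoffelChart]
    simpa only [(φ x₀).right_inv (hs hp)] using ((isAffineAt_iff_christoffel hq).1 (hf p hp)).2 v w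

lemma contDiffOn_affineCoeff_christoffelChart (A : AffineStructure m M) (x₀ : M) {n : ℕ∞ω}
    (hn : n ≤ ∞) :
    ContDiffOn ℝ n (fun p ↦ affineCoeff (christoffelChart A x₀ p)) (φ x₀).target :=
  contDiff_affineCoeff.comp_contDiffOn ((contDiffOn_christoffelChart A x₀).of_le hn)

lemma isIntegrableAt_affineCoeff_christoffelChart (hA : IsFlat A.conn) {p : E}
    (hp : p ∈ (φ x₀).target) :
    IsIntegrableAt (fun p ↦ affineCoeff (christoffelChart A x₀ p)) p :=
  isIntegrableAt_affineCoeff (differentiableAt_christoffelChart A hp)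
    (christoffel_symm A ((φ x₀).map_target hp)) (curvature_christoffelChart hA hp)

lemma IsTotalSolutionOn.isAffineAt {s : Set E} {u : E → Jet E}
    (hu : IsTotalSolutionOn (fun p ↦ affineCoeff (christoffelChart A x₀ p)) u s)
    (hs : IsOpen s) (hsub : s ⊆ (φ x₀).target) (hq : q ∈ (φ x₀).source) (hqs : φ x₀ q ∈ s) :
    IsAffineAt A (fun x ↦ (u (φ x₀ x)).1) q ∧
      jetAt (fun x ↦ (u (φ x₀ x)).1) q = ((u (φ x₀ q)).1, (u (φ x₀ q)).2 ∘L chartMap x₀ q) := by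
  have hu1 : ContDiffAt ℝ ∞ (fun p ↦ (u p).1) (φ x₀ q) := ((hu.contDiffOn hs
    ((contDiffOn_affineCoeff_christoffelChart A x₀ le_rfl).mono hsub)).contDiffAt
      (hs.mem_nhds hqs)).fst
  have hf : ContMDiffAt (𝓡 m) 𝓘(ℝ, ℝ) ∞ ((fun p ↦ (u p).1) ∘ φ x₀) q :=
    hu1.contMDiffAt.comp q (contMDiffAt_extChartAt' (by rwa [← extChartAt_source (𝓡 m)]))
  have hloc : ((fun p ↦ (u p).1) ∘ φ x₀) ∘ (φ x₀).symm =ᶠ[𝓝 (φ x₀ q)] fun p ↦ (u p).1 := by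
    filter_upwards [hs.mem_nhds hqs] with p hp
    rw [Function.comp_apply, Function.comp_apply, (φ x₀).right_inv (hsub hp)]
  refine ⟨(isAffineAt_iff_christoffel hq).2 ⟨hf, fun v w ↦ ?_⟩, ?_⟩
  · change fderiv ℝ (fderiv ℝ (((fun p ↦ (u p).1) ∘ φ x₀) ∘ (φ x₀).symm)) _ v w =
      fderiv ℝ (((fun p ↦ (u p).1) ∘ φ x₀) ∘ (φ x₀).symm) _ _
    rw [hloc.fderiv.fderiv_eq, hloc.fderiv_eq, hu.fderiv_fderiv_fst hs hqs,
      (hu.hasFDerivAt_fst hqs).fderiv, christoffelChart, (φ x₀).left_inv hq]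
  · refine (jetAt_eq_comp_chartMap hq (hf.mdifferentiableAt (by simp))).trans ?_
    rw [hloc.fderiv_eq, (hu.hasFDerivAt_fst hqs).fderiv, Function.comp_apply]

lemma eventuallyEq_of_isAffineAt (hf : ∀ᶠ x in 𝓝 q, IsAffineAt A f x)
    (hf' : ∀ᶠ x in 𝓝 q, IsAffineAt A f' x) (h : jetAt (m := m) f q = jetAt f' q) :
    f =ᶠ[𝓝 q] f' := by
  have hq := mem_extChartAt_source (I := 𝓡 m) q
  have hev : ∀ᶠ p in 𝓝 (φ q q), p ∈ (φ q).target ∧ IsAffineAt A f ((φ q).symm p) ∧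
      IsAffineAt A f' ((φ q).symm p) := by
    have hsymm := (continuousAt_extChartAt_symm (I := 𝓡 m) q).tendsto
    rw [(φ q).left_inv hq] at hsymm
    exact ((isOpen_extChartAt_target q).eventually_mem ((φ q).map_source hq)).and
      (hsymm.eventually (hf.and hf'))
  obtain ⟨r, hr, hball⟩ := eventually_nhds_iff_ball.1 hev
  have hsub : ball (φ q q) r ⊆ (φ q).target := fun p hp ↦ (hball p hp).1
  rw [jetAt_eq_comp_chartMap hq (hf.self_of_nhds.1.mdifferentiableAt (by simp)),
    jetAt_eq_comp_chartMap hq (hf'.self_of_nhds.1.mdifferentiableAt (by simp))] at h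
  have hjet : (f q, fderiv ℝ (f ∘ (φ q).symm) (φ q q)) =
      (f' q, fderiv ℝ (f' ∘ (φ q).symm) (φ q q)) := (bijective_comp_chartMap hq).1 h
  have heq := (isTotalSolutionOn_of_isAffineAt hsub fun p hp ↦ (hball p hp).2.1).eqOn
    (convex_ball (φ q q) r)
    ((contDiffOn_affineCoeff_christoffelChart A q le_rfl).continuousOn.mono hsub)
    (isTotalSolutionOn_of_isAffineAt hsub fun p hp ↦ (hball p hp).2.2) (mem_ball_self hr)
    (by simpa only [Function.comp_apply, (φ q).left_inv hq] using hjet)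
  filter_upwards [(continuousAt_extChartAt (I := 𝓡 m) q).eventually_mem (ball_mem_nhds _ hr),
    extChartAt_source_mem_nhds_of_mem hq] with x hx hxq
  simpa only [Function.comp_apply, (φ q).left_inv hxq] using congrArg Prod.fst (heq hx)

lemma exists_local_affine (hA : IsFlat A.conn) (x₀ : M) :
    ∃ (V : Set M) (f : Jet E → M → ℝ), IsOpen V ∧ x₀ ∈ V ∧ (∀ c, ∀ x ∈ V, IsAffineAt A (f c) x) ∧
      ∀ x ∈ V, Function.Bijective fun c ↦ jetAt (m := m) (f c) x := by
  have hx₀ := mem_extChartAt_source (I := 𝓡 m) x₀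
  obtain ⟨r, hr, hsub, u, hu, hbij⟩ := exists_ball_bijective_isTotalSolutionOn
    (contDiffOn_affineCoeff_christoffelChart A x₀ (n := 1) ENat.LEInfty.out)
    (fun p hp ↦ isIntegrableAt_affineCoeff_christoffelChart hA hp)
    ((isOpen_extChartAt_target x₀).mem_nhds ((φ x₀).map_source hx₀))
  have haff (c : Jet E) {x : M} (hx : x ∈ (φ x₀).source ∩ φ x₀ ⁻¹' ball (φ x₀ x₀) r) :=
    (hu c).isAffineAt isOpen_ball hsub hx.1 hx.2
  refine ⟨(φ x₀).source ∩ φ x₀ ⁻¹' ball (φ x₀ x₀) r, fun c x ↦ (u c (φ x₀ x)).1,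
    (continuousOn_extChartAt x₀).isOpen_inter_preimage (isOpen_extChartAt_source x₀) isOpen_ball,
    ⟨hx₀, mem_ball_self hr⟩, fun c x hx ↦ (haff c hx).1, fun x hx ↦ ?_⟩
  rw [show (fun c ↦ jetAt (fun x ↦ (u c (φ x₀ x)).1) x) = _ from funext fun c ↦ (haff c hx).2]
  exact (bijective_comp_chartMap hx.1).comp (hbij _ hx.2)

theorem exists_affine [SimplyConnectedSpace M] (hA : IsFlat A.conn) (P : M)
    (c : ℝ × (TangentSpace (𝓡 m) P →L[ℝ] ℝ)) :
    ∃ f : M → ℝ, (∀ x, IsAffineAt A f x) ∧ jetAt f P = c := by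
  have := ChartedSpace.locallyPathConnectedSpace E M
  choose V f hV hmem haff hbij using exists_local_affine hA
  have haffnear {i x : M} (hx : x ∈ V i) (c : Jet E) : ∀ᶠ y in 𝓝 x, IsAffineAt A (f i c) y :=
    ((hV i).eventually_mem hx).mono fun y hy ↦ haff i c y hy
  obtain ⟨c₀, rfl⟩ := (hbij P P (hmem P)).2 c
  obtain ⟨s, hsP, hs⟩ := exists_section_of_localSystem hV hmem hbij
    (fun i j x hx c d hcd ↦ (eventuallyEq_of_isAffineAt (haffnear hx.1 c) (haffnear hx.2 d)
      hcd).eventuallyEq_nhds.mono fun y hy ↦ jetAt_congr hy) P c₀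
  choose d hd using hs
  have hloc (i : M) : (fun x ↦ (s x).1) =ᶠ[𝓝 i] f i (d i) :=
    (hd i).mono fun x hx ↦ congrArg Prod.fst hx
  refine ⟨fun x ↦ (s x).1, fun i ↦ (haff i _ i (hmem i)).congr (hloc i), ?_⟩
  exact (jetAt_congr (hloc P)).trans ((hd P).self_of_nhds.symm.trans hsP)

end AffineFunctions

section ProjectiveChange

open Set Filter Topology

variable {m : ℕ} {M : Type*} [TopologicalSpace M] [ChartedSpace (EuclideanSpace ℝ (Fin m)) M]
  {x : M} {h f : M → ℝ}

local notation "E" => EuclideanSpace ℝ (Fin m)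
local notation "𝐝" => mvfderiv (𝓡 m)

lemma mvfderiv_exp (hh : MDifferentiableAt (𝓡 m) 𝓘(ℝ, ℝ) h x) :
    𝐝 (fun x ↦ Real.exp (h x)) x = Real.exp (h x) • 𝐝 h x := by
  ext v
  have hcomp := mfderiv_comp_apply x (Real.differentiableAt_exp (x := h x)).mdifferentiableAt hh v
  rw [mfderiv_eq_fderiv, (Real.hasDerivAt_exp (h x)).hasFDerivAt.fderiv] at hcomp
  exact hcomp.trans (mul_comm (𝐝 h x v) (Real.exp (h x)))

lemma mvfderiv_exp_mul (hh : MDifferentiableAt (𝓡 m) 𝓘(ℝ, ℝ) h x)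
    (hf : MDifferentiableAt (𝓡 m) 𝓘(ℝ, ℝ) f x) (v : TangentSpace (𝓡 m) x) :
    𝐝 (fun x ↦ Real.exp (h x) * f x) x v = Real.exp (h x) * (𝐝 h x v * f x + 𝐝 f x v) := by
  have hexp : MDifferentiableAt (𝓡 m) 𝓘(ℝ, ℝ) (fun x ↦ Real.exp (h x)) x :=
    Real.differentiableAt_exp.comp_mdifferentiableAt hh
  rw [mvfderiv_fun_mul hexp hf]
  simp only [add_apply, smul_apply, mvfderiv_exp hh, smul_eq_mul]
  ring

variable [IsManifold (𝓡 m) ∞ M] {A A₀ : AffineStructure m M}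

/-- `A` arises from `A₀` by the projective change `∇_X Y = ∇⁰_X Y + X(h) Y + Y(h) X`. -/
def IsProjectiveChange (A A₀ : AffineStructure m M) (h : M → ℝ) : Prop :=
  ∀ (Y : Π x : M, TangentSpace (𝓡 m) x) (x : M), VFDiffAt Y x → ∀ v : TangentSpace (𝓡 m) x,
    A.conn Y x v = A₀.conn Y x v + 𝐝 h x v • Y x + 𝐝 h x (Y x) • v

/-- The bilinear form `Hess h - dh ⊗ dh`, as a linear form in its first argument. -/
def projForm (A₀ : AffineStructure m M) (h : M → ℝ) (Z : SmoothVF m M) (x : M) :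
    TangentSpace (𝓡 m) x →L[ℝ] ℝ :=
  𝐝 (fun q ↦ 𝐝 h q (Z q)) x - 𝐝 h x ∘L A₀.conn Z x - 𝐝 h x (Z x) • 𝐝 h x

lemma projForm_apply (A₀ : AffineStructure m M) (h : M → ℝ) (X Z : SmoothVF m M) (x : M) :
    projForm A₀ h Z x (X x) = A₀.hessian h X Z x - 𝐝 h x (Z x) * 𝐝 h x (X x) := rfl

lemma projForm_symm (hh : ContMDiff (𝓡 m) 𝓘(ℝ, ℝ) ∞ h) (X Z : SmoothVF m M) (x : M) :
    projForm A₀ h Z x (X x) = projForm A₀ h X x (Z x) := by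
  rw [projForm_apply, projForm_apply, A₀.hessian_symm (hh x), mul_comm]

lemma IsProjectiveChange.conn_conn (hA : IsProjectiveChange A A₀ h)
    (hh : ContMDiff (𝓡 m) 𝓘(ℝ, ℝ) ∞ h) (Y Z : SmoothVF m M) (x : M) (v : TangentSpace (𝓡 m) x) :
    A.conn (fun q ↦ A.conn Z q (Y q)) x v =
      A₀.conn (fun q ↦ A₀.conn Z q (Y q)) x v +
      (𝐝 h x (Y x) • A₀.conn Z x v + 𝐝 (fun q ↦ 𝐝 h q (Y q)) x v • Z x) +
      (𝐝 h x (Z x) • A₀.conn Y x v + 𝐝 (fun q ↦ 𝐝 h q (Z q)) x v • Y x) +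
      𝐝 h x v • (A₀.conn Z x (Y x) + 𝐝 h x (Y x) • Z x + 𝐝 h x (Z x) • Y x) +
      (𝐝 h x (A₀.conn Z x (Y x)) + 2 * 𝐝 h x (Y x) * 𝐝 h x (Z x)) • v := by
  have hZY : (fun q ↦ A.conn Z q (Y q)) = (fun q ↦ A₀.conn Z q (Y q)) +
      (fun q ↦ 𝐝 h q (Y q)) • (Z : Π x : M, TangentSpace (𝓡 m) x) +
      (fun q ↦ 𝐝 h q (Z q)) • (Y : Π x : M, TangentSpace (𝓡 m) x) :=
    funext fun q ↦ hA Z q (vfDiffAt_smoothVF Z q) (Y q)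
  have hY := vfDiffAt_smoothVF Y x
  have hZ := vfDiffAt_smoothVF Z x
  have hdY := mdifferentiableAt_mvfderiv_apply (hh x) hY
  have hdZ := mdifferentiableAt_mvfderiv_apply (hh x) hZ
  have hA₀ZY := A₀.mdifferentiableAt_conn Z hY
  have hdYZ : VFDiffAt ((fun q ↦ 𝐝 h q (Y q)) • (Z : Π x : M, TangentSpace (𝓡 m) x)) x :=
    hdY.smul_section hZ
  have hdZY : VFDiffAt ((fun q ↦ 𝐝 h q (Z q)) • (Y : Π x : M, TangentSpace (𝓡 m) x)) x :=
    hdZ.smul_section hY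
  have hconn : A₀.conn (fun q ↦ A.conn Z q (Y q)) x = A₀.conn _ x :=
    congrArg (fun W : Π x : M, TangentSpace (𝓡 m) x ↦ A₀.conn W x) hZY
  rw [A₀.conn.isCovariantDerivativeOnUniv.add (mdifferentiableAt_add_section hA₀ZY hdYZ) hdZY,
    A₀.conn.isCovariantDerivativeOnUniv.add hA₀ZY hdYZ,
    A₀.conn.isCovariantDerivativeOnUniv.leibniz hZ hdY,
    A₀.conn.isCovariantDerivativeOnUniv.leibniz hY hdZ] at hconn
  rw [hA _ x (A.mdifferentiableAt_conn Z hY), hconn]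
  simp only [hA Z x hZ, add_apply, smul_apply, ContinuousLinearMap.smulRight_apply,
    map_add, map_smul, smul_eq_mul]
  module

lemma IsProjectiveChange.curvature_eq (hA : IsProjectiveChange A A₀ h) (hflat : IsFlat A₀.conn)
    (hh : ContMDiff (𝓡 m) 𝓘(ℝ, ℝ) ∞ h) (X Y Z : SmoothVF m M) (x : M) :
    curvature A.conn X Y Z x =
      projForm A₀ h Z x (X x) • Y x - projForm A₀ h Z x (Y x) • X x := by
  have htorsion := (CovariantDerivative.torsion_eq_zero_iff A₀.conn).1 A₀.torsion_free
    (vfDiffAt_smoothVF X x) (vfDiffAt_smoothVF Y x)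
  have hcurv := hflat X Y Z x
  have hess := A₀.hessian_symm (hh x) X Y
  rw [curvature, ← htorsion] at hcurv ⊢
  rw [hA.conn_conn hh, hA.conn_conn hh, hA Z x (vfDiffAt_smoothVF Z x)]
  simp only [projForm_apply, AffineStructure.hessian, map_sub] at hcurv hess ⊢
  linear_combination (norm := module) hcurv + hess • Z x

lemma IsProjectiveChange.hessian_exp_mul (hA : IsProjectiveChange A A₀ h)
    (hh : ContMDiff (𝓡 m) 𝓘(ℝ, ℝ) ∞ h) (hf : ContMDiff (𝓡 m) 𝓘(ℝ, ℝ) ∞ f)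
    (X Y : SmoothVF m M) (x : M) :
    A.hessian (fun x ↦ Real.exp (h x) * f x) X Y x =
      Real.exp (h x) * (A₀.hessian f X Y x + f x * projForm A₀ h Y x (X x)) := by
  have hhd (x : M) := (hh x).mdifferentiableAt (by simp)
  have hfd (x : M) := (hf x).mdifferentiableAt (by simp)
  have hhY := mdifferentiableAt_mvfderiv_apply (hh x) (vfDiffAt_smoothVF Y x)
  have hfY := mdifferentiableAt_mvfderiv_apply (hf x) (vfDiffAt_smoothVF Y x)
  have hhYf : MDifferentiableAt (𝓡 m) 𝓘(ℝ, ℝ) (fun q ↦ 𝐝 h q (Y q) * f q) x := hhY.mul (hfd x)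
  have hsum : MDifferentiableAt (𝓡 m) 𝓘(ℝ, ℝ) (fun q ↦ 𝐝 h q (Y q) * f q + 𝐝 f q (Y q)) x :=
    hhYf.add hfY
  have hY : (fun q ↦ 𝐝 (fun x ↦ Real.exp (h x) * f x) q (Y q)) = fun q ↦
      Real.exp (h q) * (𝐝 h q (Y q) * f q + 𝐝 f q (Y q)) :=
    funext fun q ↦ mvfderiv_exp_mul (hhd q) (hfd q) (Y q)
  rw [projForm_apply, AffineStructure.hessian, hY, mvfderiv_exp_mul (hhd x) hsum,
    mvfderiv_fun_add hhYf hfY, mvfderiv_fun_mul hhY (hfd x), mvfderiv_exp_mul (hhd x) (hfd x),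
    hA Y x (vfDiffAt_smoothVF Y x), AffineStructure.hessian, AffineStructure.hessian]
  simp only [add_apply, smul_apply, smul_eq_mul, map_add, map_smul]
  ring

variable [T2Space M]

lemma AffineStructure.IsStronglyProjectivelyFlat.exists_isProjectiveChange
    (hA : A.IsStronglyProjectivelyFlat) :
    ∃ (A₀ : AffineStructure m M) (h : M → ℝ), IsFlat A₀.conn ∧
      ContMDiff (𝓡 m) 𝓘(ℝ, ℝ) ∞ h ∧ IsProjectiveChange A A₀ h := by
  obtain ⟨A₀, hflat, g, hg⟩ := hA
  refine ⟨A₀, -g, hflat, g.contMDiff.neg, fun Y x hY v ↦ ?_⟩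
  obtain ⟨X, rfl⟩ := exists_smoothVF_apply_eq x v
  rw [hg Y x hY, perturb_apply A.conn g X Y x, mvfderiv_neg]
  simp only [neg_apply]
  module

lemma IsProjectiveChange.ricci_eq (hA : IsProjectiveChange A A₀ h) (hflat : IsFlat A₀.conn)
    (hh : ContMDiff (𝓡 m) 𝓘(ℝ, ℝ) ∞ h) (Y Z : SmoothVF m M) (x : M) :
    A.ricci Y Z x = -((m : ℝ) - 1) * projForm A₀ h Z x (Y x) := by
  have hcurv : (TensorialAt.mkHom (fun X ↦ curvature A.conn X Y Z x) x
      (A.tensorialAt_curvature Y Z x)).toLinearMap =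
      ((projForm A₀ h Z x).toLinearMap.smulRight (Y x) : TangentSpace (𝓡 m) x →ₗ[ℝ] _) -
        projForm A₀ h Z x (Y x) • LinearMap.id := by
    refine LinearMap.ext fun v ↦ ?_
    obtain ⟨X, rfl⟩ := exists_smoothVF_apply_eq x v
    exact (TensorialAt.mkHom_apply (A.tensorialAt_curvature Y Z x) (vfDiffAt_smoothVF X x)).trans
      (hA.curvature_eq hflat hh X Y Z x)
  have hrank : Module.finrank ℝ (TangentSpace (𝓡 m) x) = m :=
    finrank_euclideanSpace_fin (𝕜 := ℝ) (n := m)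
  have : Module.Free ℝ (TangentSpace (𝓡 m) x) := inferInstanceAs (Module.Free ℝ E)
  have : Module.Finite ℝ (TangentSpace (𝓡 m) x) := inferInstanceAs (Module.Finite ℝ E)
  rw [AffineStructure.ricci, hcurv, map_sub, map_smul, LinearMap.trace_smulRight,
    LinearMap.trace_id, hrank, ContinuousLinearMap.coe_coe, smul_eq_mul]
  ring

lemma IsProjectiveChange.ricciSym_eq (hA : IsProjectiveChange A A₀ h) (hflat : IsFlat A₀.conn)
    (hh : ContMDiff (𝓡 m) 𝓘(ℝ, ℝ) ∞ h) (Y Z : SmoothVF m M) (x : M) :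
    A.ricciSym Y Z x = -((m : ℝ) - 1) * projForm A₀ h Z x (Y x) := by
  rw [AffineStructure.ricciSym, hA.ricci_eq hflat hh, hA.ricci_eq hflat hh, projForm_symm hh Y Z]
  ring

lemma IsProjectiveChange.exp_mul_mem_solutionSpace (hA : IsProjectiveChange A A₀ h)
    (hm : 2 ≤ m) (hflat : IsFlat A₀.conn) (hh : ContMDiff (𝓡 m) 𝓘(ℝ, ℝ) ∞ h)
    (hf : ∀ x, IsAffineAt A₀ f x) :
    (fun x ↦ Real.exp (h x) * f x) ∈ A.solutionSpace := by
  have hfsmooth : ContMDiff (𝓡 m) 𝓘(ℝ, ℝ) ∞ f := fun x ↦ (hf x).1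
  refine ⟨(Real.contDiff_exp.contMDiff.comp hh).mul hfsmooth, fun X Y x ↦ ?_⟩
  have hm1 : (m : ℝ) - 1 ≠ 0 := sub_ne_zero.2 (by exact_mod_cast (by omega : m ≠ 1))
  rw [hA.hessian_exp_mul hh hfsmooth, hA.ricciSym_eq hflat hh, (hf x).2 X Y]
  field_simp
  ring

theorem AffineStructure.IsStronglyProjectivelyFlat.exists_mem_solutionSpace
    [SimplyConnectedSpace M] (hA : A.IsStronglyProjectivelyFlat) (hm : 2 ≤ m) (x : M)
    (α : TangentSpace (𝓡 m) x →L[ℝ] ℝ) : ∃ f ∈ A.solutionSpace, f x = 0 ∧ 𝐝 f x = α := by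
  obtain ⟨A₀, h, hflat, hh, hAh⟩ := hA.exists_isProjectiveChange
  obtain ⟨f, hf, hfx⟩ := exists_affine hflat x (0, Real.exp (-h x) • α)
  have hfx0 : f x = 0 := congrArg Prod.fst hfx
  have hdf : 𝐝 f x = Real.exp (-h x) • α := congrArg Prod.snd hfx
  refine ⟨_, hAh.exp_mul_mem_solutionSpace hm hflat hh hf, by simp [hfx0], ?_⟩
  refine ContinuousLinearMap.ext fun v ↦ ?_
  rw [mvfderiv_exp_mul ((hh x).mdifferentiableAt (by simp))
    ((hf x).1.mdifferentiableAt (by simp)), hfx0, hdf, smul_apply, smul_eq_mul, mul_zero, zero_add,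
    ← mul_assoc, ← Real.exp_add, add_neg_cancel, Real.exp_zero, one_mul]

end ProjectiveChange

section Rigidity

variable {m : ℕ} {M : Type*} [TopologicalSpace M] [ChartedSpace (EuclideanSpace ℝ (Fin m)) M]

local notation "E" => EuclideanSpace ℝ (Fin m)
local notation "𝐝" => mvfderiv (𝓡 m)

lemma mfderiv_symm_mfderiv (Ξ : M ≃ₘ⟮𝓡 m, 𝓡 m⟯ M) (x : M) (v : TangentSpace (𝓡 m) x) :
    mfderiv (𝓡 m) (𝓡 m) Ξ.symm (Ξ x) (mfderiv (𝓡 m) (𝓡 m) Ξ x v) = v := by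
  have hcomp := mfderiv_comp_apply x (Ξ.symm.contMDiff.mdifferentiable (by simp) (Ξ x))
    (Ξ.contMDiff.mdifferentiable (by simp) x) v
  have hid : (Ξ.symm ∘ Ξ : M → M) = id := funext Ξ.symm_apply_apply
  rw [hid, mfderiv_id] at hcomp
  exact hcomp.symm

lemma isInvertible_mfderiv (Ξ : M ≃ₘ⟮𝓡 m, 𝓡 m⟯ M) (x : M) :
    (mfderiv (𝓡 m) (𝓡 m) Ξ x).IsInvertible :=
  ⟨Ξ.mfderivToContinuousLinearEquiv (by simp) x, rfl⟩

lemma mpullback_symm_apply (Ξ : M ≃ₘ⟮𝓡 m, 𝓡 m⟯ M) (Y : Π x : M, TangentSpace (𝓡 m) x) (x : M) :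
    mpullback (𝓡 m) (𝓡 m) Ξ.symm Y (Ξ x) = mfderiv (𝓡 m) (𝓡 m) Ξ x (Y x) := by
  have hY : (Y (Ξ.symm (Ξ x)) : E) = Y x :=
    congrArg (fun y ↦ (Y y : E)) (Ξ.symm_apply_apply x)
  rw [mpullback_apply, (isInvertible_mfderiv Ξ.symm (Ξ x)).inverse_apply_eq]
  exact hY.trans (mfderiv_symm_mfderiv Ξ x (Y x)).symm

lemma mvfderiv_comp_diffeomorph (Ξ : M ≃ₘ⟮𝓡 m, 𝓡 m⟯ M) {f : M → ℝ} {x : M}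
    (hf : MDifferentiableAt (𝓡 m) 𝓘(ℝ, ℝ) f (Ξ x)) (v : TangentSpace (𝓡 m) x) :
    𝐝 (f ∘ Ξ) x v = 𝐝 f (Ξ x) (mfderiv (𝓡 m) (𝓡 m) Ξ x v) :=
  mvfderiv_comp_apply x hf (Ξ.contMDiff.mdifferentiable (by simp) x) v

variable [IsManifold (𝓡 m) ∞ M]

lemma pullbackConnection_refl (D : TangentConnection m M) (Y : Π x : M, TangentSpace (𝓡 m) x)
    (x : M) : pullbackConnection (Diffeomorph.refl (𝓡 m) M ∞) D Y x = D Y x := by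
  change (mfderiv (𝓡 m) (𝓡 m) id x).inverse ∘L (D (mpullback (𝓡 m) (𝓡 m) id Y) x) ∘L
    (mfderiv (𝓡 m) (𝓡 m) id x) = _
  rw [mpullback_id, mfderiv_id]
  exact congrArg (fun L : TangentSpace (𝓡 m) x →L[ℝ] TangentSpace (𝓡 m) x ↦ L ∘L D Y x)
    ContinuousLinearMap.inverse_id

/-- The push-forward `Ξ_* Y` of a smooth vector field by a diffeomorphism, encoded as the pullback
by the inverse. -/
def pushforwardVF (Ξ : M ≃ₘ⟮𝓡 m, 𝓡 m⟯ M) (Y : SmoothVF m M) : SmoothVF m M :=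
  ⟨mpullback (𝓡 m) (𝓡 m) Ξ.symm Y,
    ContMDiff.mpullback_vectorField (n := ∞) Y.contMDiff Ξ.symm.contMDiff
      (isInvertible_mfderiv Ξ.symm) (by simp)⟩

lemma pushforwardVF_apply (Ξ : M ≃ₘ⟮𝓡 m, 𝓡 m⟯ M) (Y : SmoothVF m M) (x : M) :
    pushforwardVF Ξ Y (Ξ x) = mfderiv (𝓡 m) (𝓡 m) Ξ x (Y x) :=
  mpullback_symm_apply Ξ Y x

lemma AffineStructure.hessian_comp_diffeomorph (A : AffineStructure m M)
    (Ξ : M ≃ₘ⟮𝓡 m, 𝓡 m⟯ M) {f : M → ℝ} (hf : ContMDiff (𝓡 m) 𝓘(ℝ, ℝ) ∞ f) (X Y : SmoothVF m M)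
    (x : M) :
    A.hessian (f ∘ Ξ) X Y x =
      𝐝 (fun q ↦ 𝐝 f q (pushforwardVF Ξ Y q)) (Ξ x) (pushforwardVF Ξ X (Ξ x)) -
        𝐝 f (Ξ x) (mfderiv (𝓡 m) (𝓡 m) Ξ x (A.conn Y x (X x))) := by
  have hfd (y : M) := (hf y).mdifferentiableAt (by simp)
  have hY : (fun q ↦ 𝐝 (f ∘ Ξ) q (Y q)) = (fun q ↦ 𝐝 f q (pushforwardVF Ξ Y q)) ∘ Ξ :=
    funext fun q ↦ by
      rw [mvfderiv_comp_diffeomorph Ξ (hfd _), Function.comp_apply, pushforwardVF_apply]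
  rw [AffineStructure.hessian, hY, mvfderiv_comp_diffeomorph Ξ (hfd _), mvfderiv_comp_diffeomorph Ξ
    (mdifferentiableAt_mvfderiv_apply (hf _) (vfDiffAt_smoothVF (pushforwardVF Ξ Y) _)),
    pushforwardVF_apply]

lemma AffineStructure.hessian_eq_zero_of_mem_solutionSpace {A : AffineStructure m M} {f : M → ℝ}
    (hf : f ∈ A.solutionSpace) {x : M} (hfx : f x = 0) (X Y : SmoothVF m M) :
    A.hessian f X Y x = 0 := by
  simpa only [hfx, mul_zero, zero_mul, add_zero] using hf.2 X Y x

variable [T2Space M]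

lemma sameConnection_of_smoothVF {D D' : TangentConnection m M}
    (hDD' : ∀ (Y : SmoothVF m M) (x : M), D Y x = D' Y x) : SameConnection D D' := by
  intro Y x hY
  obtain ⟨Z, hZ⟩ := exists_smoothVF_apply_eq x (Y x)
  have hdiff {W : Π x : M, TangentSpace (𝓡 m) x} (hW : VFDiffAt W x) :
      D.isCovariantDerivativeOnUniv.difference D'.isCovariantDerivativeOnUniv x (W x) =
        D W x - D' W x :=
    IsCovariantDerivativeOn.difference_apply _ _ (hσ := hW)
  rw [← sub_eq_zero]
  refine (hdiff hY).symm.trans ?_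
  rw [← hZ, hdiff (vfDiffAt_smoothVF Z x)]
  exact sub_eq_zero.2 (hDD' Z x)

theorem sameConnection_pullbackConnection [SimplyConnectedSpace M] (hm : 2 ≤ m)
    {A₁ A₂ : AffineStructure m M} (hA₁ : A₁.IsStronglyProjectivelyFlat) (Ξ : M ≃ₘ⟮𝓡 m, 𝓡 m⟯ M)
    (hΞ : ∀ f ∈ A₁.solutionSpace, f ∘ Ξ ∈ A₂.solutionSpace) :
    SameConnection (pullbackConnection Ξ A₁.conn) A₂.conn := by
  refine sameConnection_of_smoothVF fun Y x ↦ ContinuousLinearMap.ext fun v ↦ ?_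
  obtain ⟨X, rfl⟩ := exists_smoothVF_apply_eq x v
  refine (isInvertible_mfderiv Ξ x).inverse_apply_eq.2 ?_
  have hdual (α : E →L[ℝ] ℝ) :
      α (A₁.conn (pushforwardVF Ξ Y) (Ξ x) (mfderiv (𝓡 m) (𝓡 m) Ξ x (X x))) =
        α (mfderiv (𝓡 m) (𝓡 m) Ξ x (A₂.conn Y x (X x))) := by
    obtain ⟨f, hf, hfx, rfl⟩ := hA₁.exists_mem_solutionSpace hm (Ξ x) α
    have hess₁ := A₁.hessian_eq_zero_of_mem_solutionSpace hf hfx (pushforwardVF Ξ X)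
      (pushforwardVF Ξ Y)
    have hess₂ := A₂.hessian_eq_zero_of_mem_solutionSpace (hΞ f hf) hfx X Y
    rw [A₂.hessian_comp_diffeomorph Ξ hf.1, sub_eq_zero] at hess₂
    rw [AffineStructure.hessian, sub_eq_zero, hess₂, pushforwardVF_apply] at hess₁
    exact hess₁.symm
  exact (SeparatingDual.eq_iff_forall_dual_eq (R := ℝ) (V := E)).2 hdual

end Rigidity

end AffineGeometry

end

open AffineGeometry in
theorem theorem1p4_general {m : ℕ} (hm : 2 ≤ m) {M : Type*} [TopologicalSpace M] [T2Space M]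
    [ChartedSpace (EuclideanSpace ℝ (Fin m)) M] [IsManifold (𝓡 m) ∞ M] [SimplyConnectedSpace M]
    (A₁ A₂ : AffineStructure m M) (h₁ : A₁.IsStronglyProjectivelyFlat) (Ξ : M ≃ₘ⟮𝓡 m, 𝓡 m⟯ M) :
    (A₁.solutionSpace ⊆ A₂.solutionSpace → SameConnection A₁.conn A₂.conn) ∧
    ((fun f : M → ℝ ↦ f ∘ Ξ) '' A₁.solutionSpace ⊆ A₂.solutionSpace →
      SameConnection (pullbackConnection Ξ A₁.conn) A₂.conn) := by
  refine ⟨fun h Y x hY ↦ ?_, fun h ↦ ?_⟩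
  · rw [← pullbackConnection_refl]
    exact sameConnection_pullbackConnection hm h₁ (Diffeomorph.refl (𝓡 m) M ∞) (fun _ hf ↦ h hf)
      Y x hY
  · exact sameConnection_pullbackConnection hm h₁ Ξ fun f hf ↦ h ⟨f, hf, rfl⟩

open AffineGeometry in
theorem theorem1p4 {m : ℕ} (hm : 2 ≤ m) {M : Type*} [TopologicalSpace M] [T2Space M]
    [ChartedSpace (EuclideanSpace ℝ (Fin m)) M] [IsManifold (𝓡 m) ∞ M] [SimplyConnectedSpace M]
    (A₁ A₂ : AffineStructure m M)
    (h₁ : A₁.IsStronglyProjectivelyFlat) (h₂ : A₂.IsStronglyProjectivelyFlat)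
    (Ξ : M ≃ₘ⟮𝓡 m, 𝓡 m⟯ M) :
    (A₁.solutionSpace = A₂.solutionSpace → SameConnection A₁.conn A₂.conn) ∧
    ((fun f : M → ℝ ↦ f ∘ Ξ) '' A₁.solutionSpace = A₂.solutionSpace →
      SameConnection (pullbackConnection Ξ A₁.conn) A₂.conn) := by
  have h := theorem1p4_general hm A₁ A₂ h₁ Ξ
  exact ⟨fun hQ ↦ h.1 hQ.subset, fun hQ ↦ h.2 hQ.subset⟩
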